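/- Let $n\ge 1$, let $M$ be a compact smooth $n$-dimensional manifold with (possibly empty) boundary $\partial M$, and let $x: M\to \bar{\mathbb{B}}^{n+1}\subset\mathbb{R}^{n+1}$ be a smooth immersion into the closed Euclidean unit ball with $x(\partial M)\subset \partial\mathbb{B}^{n+1}$, equipped with a smooth unit normal vector field $\nu$ along $x$. Let $M$ carry the induced metric $g$ with area element $dA$, and let $h(X,Y)=\langle d\nu(X), dx(Y)\rangle$ and $H=\mathrm{tr}_g h$ be the second fundamental form and the mean curvature with respect to $\nu$. Suppose that $x(M)$ meets the unit sphere along $\partial M$ at a constant angle $\theta\in(0,\pi)$, that is, at every point of $\partial M$ the angle between $-\nu$ and the outward unit normal $\bar N=x$ of the ball equals $\theta$ (equivalently $\langle \nu,x\rangle=-\cos\theta$ on $\partial M$). For a constant vector $a\in\mathbb{R}^{n+1}$ let $$X_a=\langle x,a\rangle x-\tfrac12(|x|^2+1)a .$$ Then both integrands below are integrable on $M$ and $$\int_M n\langle x+\cos\theta\,\nu,a\rangle\,dA=\int_M H\langle X_a,\nu\rangle\,dA .$$ In particular, in the free boundary case $\theta=\pi/2$, $$n\int_M\langle x,a\rangle\,dA=\int_M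 H\langle X_a,\nu\rangle\,dA .$$ -/

import Mathlib

open MeasureTheory Set
open scoped Manifold ContDiff RealInnerProductSpace

noncomputable section

namespace CapillaryBall

/-- The vector field `X_a(y) = ⟨y, a⟩ y - ½ (|y|² + 1) a` on `ℝ^{n+1}`. -/
def confField {n : ℕ} (a y : EuclideanSpace ℝ (Fin (n + 1))) : EuclideanSpace ℝ (Fin (n + 1)) :=
  ⟪y, a⟫ • y - ((1 / 2 : ℝ) * (‖y‖ ^ 2 + 1)) • a

section Hypersurface

variable {n : ℕ} [NeZero n] {M : Type*} [TopologicalSpace M] [ChartedSpace (EuclideanHalfSpace n) M]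

/-- The differential at `p` of a map `f : M → ℝ^{n+1}`, as a linear map from the tangent space
of `M` at `p` (which is identified with `ℝⁿ` through the preferred chart at `p`) to `ℝ^{n+1}`. -/
def diff (f : M → EuclideanSpace ℝ (Fin (n + 1))) (p : M) :
    EuclideanSpace ℝ (Fin n) →L[ℝ] EuclideanSpace ℝ (Fin (n + 1)) :=
  mfderiv (𝓡∂ n) 𝓘(ℝ, EuclideanSpace ℝ (Fin (n + 1))) f p

/-- `x : M → ℝ^{n+1}` is a smooth immersion (up to and including the boundary of `M`). -/
structure IsSmoothImmersion (x : M → EuclideanSpace ℝ (Fin (n + 1))) : Prop where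
  smooth : ContMDiff (𝓡∂ n) 𝓘(ℝ, EuclideanSpace ℝ (Fin (n + 1))) ∞ x
  injective_diff : ∀ p, Function.Injective (diff x p)

/-- `ν` is a smooth unit normal vector field along `x`. -/
structure IsUnitNormal (x ν : M → EuclideanSpace ℝ (Fin (n + 1))) : Prop where
  smooth : ContMDiff (𝓡∂ n) 𝓘(ℝ, EuclideanSpace ℝ (Fin (n + 1))) ∞ ν
  norm_eq_one : ∀ p, ‖ν p‖ = 1
  inner_eq_zero : ∀ p v, ⟪ν p, diff x p v⟫ = 0

/-- The first fundamental form `g(u, v) = ⟨dx(u), dx(v)⟩` at `p`, as the Gram matrix `(g_ij)` with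
respect to the standard basis of the tangent space. -/
def firstForm (x : M → EuclideanSpace ℝ (Fin (n + 1))) (p : M) : Matrix (Fin n) (Fin n) ℝ :=
  Matrix.of fun i j =>
    ⟪diff x p (EuclideanSpace.single i 1), diff x p (EuclideanSpace.single j 1)⟫

/-- The second fundamental form `h(u, v) = ⟨dν(u), dx(v)⟩` at `p`, as the matrix `(h_ij)` with
respect to the standard basis of the tangent space. -/
def secondForm (x ν : M → EuclideanSpace ℝ (Fin (n + 1))) (p : M) : Matrix (Fin n) (Fin n) ℝ :=
  Matrix.of fun i j =>
    ⟪diff ν p (EuclideanSpace.single i 1), diff x p (EuclideanSpace.single j 1)⟫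

/-- The mean curvature `H = tr_g h = ∑ g^{ij} h_{ij}` (the sum, not the average, of the principal
curvatures; it is `n` for the unit sphere with its outward normal). -/
def meanCurvature (x ν : M → EuclideanSpace ℝ (Fin (n + 1))) (p : M) : ℝ :=
  ((firstForm x p)⁻¹ * secondForm x ν p).trace

/-- The area density `√ det (⟨∂_i (x ∘ φ⁻¹), ∂_j (x ∘ φ⁻¹)⟩)` of the metric induced by `x`, in the
preferred chart `φ` at `p`, as a function of the coordinates `y`. At boundary points of the
half-space the derivative is the one from inside the half-space. -/
def chartDensity (x : M → EuclideanSpace ℝ (Fin (n + 1))) (p : M) (y : EuclideanSpace ℝ (Fin n)) :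
    ℝ :=
  let D := fderivWithin ℝ (x ∘ (extChartAt (𝓡∂ n) p).symm) (range (𝓡∂ n)) y
  √(Matrix.det (Matrix.of fun i j : Fin n =>
    ⟪D (EuclideanSpace.single i 1), D (EuclideanSpace.single j 1)⟫))

/-- The area measure of the metric induced by `x`, on the domain of the preferred chart `φ` at `p`
(and zero outside that domain): `A ↦ ∫_{φ(A)} √ det (g_ij) dy`. -/
def chartArea [MeasurableSpace M] (x : M → EuclideanSpace ℝ (Fin (n + 1))) (p : M) : Measure M :=
  Measure.map (extChartAt (𝓡∂ n) p).symm
    ((volume.restrict (extChartAt (𝓡∂ n) p).target).withDensity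
      fun y => ENNReal.ofReal (chartDensity x p y))

/-- The area measure `dA` on `M` of the Riemannian metric induced by the immersion `x`. The measures
`chartArea x p` agree on the overlaps of the charts, and their supremum in the lattice of measures
is the measure on `M` that restricts to `chartArea x p` on each chart domain. -/
def area [MeasurableSpace M] (x : M → EuclideanSpace ℝ (Fin (n + 1))) : Measure M :=
  ⨆ p : M, chartArea x p

/-- The boundary of the hypersurface `x` lies on the unit sphere and meets it at the constant angle
`θ`: along the boundary, the angle between `-ν` and the outward unit normal of the ball, which is
the position vector `x`, equals `θ`. -/
def MeetsSphereAtAngle (x ν : M → EuclideanSpace ℝ (Fin (n + 1))) (θ : ℝ) : Prop :=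
  ∀ p ∈ (𝓡∂ n).boundary M, ‖x p‖ = 1 ∧ InnerProductGeometry.angle (-ν p) (x p) = θ

end Hypersurface

end CapillaryBall

end

/-! Write `c = cos θ`. The identity is the divergence theorem for one vector field `W` on the
hypersurface, the tangential part of `X_a + c (⟨ν, a⟩ x - ⟨x, ν⟩ a)` (`capillaryField`). The field
`X_a` is conformal: its derivative is `⟨y, a⟩` times the identity plus an antisymmetric map, and on
the unit sphere it is tangent to the sphere. The correction by `c` is orthogonal to `ν`, and it is
what makes `⟨W, x⟩` vanish along the boundary when `⟨ν, x⟩ = -c`.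

In `div W` the antisymmetric terms have zero trace, also after composition with the symmetric shape
operator. What remains is `div W = n ⟨x + c ν, a⟩ - H ⟨X_a, ν⟩` (`divergence_capillaryField`), the
last term coming from the removal of the normal part.

Since `sin θ ≠ 0`, the hypersurface is transversal to the sphere, so a tangent field orthogonal to
`x` at the boundary is tangent to the boundary. Such a field has total divergence zero
(`integral_divergence_eq_zero`). By a partition of unity it may be supported in one chart; there `√g
div W = ∑ ∂_j (√g V^j)` (`sum_fderiv_sqrt_det_mul`), and the integral over the half-space vanishes
because `V^0 = 0` on the face `y 0 = 0`. The supremum of measures defining the area is reduced to a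
single chart by `area_restrict_source`. -/

noncomputable section

namespace CapillaryBall

open Matrix Filter Topology

/-! ### Gram matrices and metric traces under a linear change of coordinates. -/

section LinearAlgebra

variable {n : ℕ} {F : Type*} [NormedAddCommGroup F] [InnerProductSpace ℝ F]

/-- The matrix `⟨B e_i, D e_j⟩` of two linear maps on `ℝⁿ`. -/
def pairing (B D : EuclideanSpace ℝ (Fin n) →L[ℝ] F) : Matrix (Fin n) (Fin n) ℝ :=
  Matrix.of fun i j => ⟪B (EuclideanSpace.single i 1), D (EuclideanSpace.single j 1)⟫

/-- The trace of `⟨B ·, D ·⟩` with respect to the inner product `⟨D ·, D ·⟩`. -/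
def metricTrace (D B : EuclideanSpace ℝ (Fin n) →L[ℝ] F) : ℝ :=
  ((pairing D D)⁻¹ * pairing B D).trace

lemma pairing_apply (B D : EuclideanSpace ℝ (Fin n) →L[ℝ] F) (i j : Fin n) :
    pairing B D i j = ⟪B (EuclideanSpace.single i 1), D (EuclideanSpace.single j 1)⟫ := rfl

lemma pairing_transpose (B D : EuclideanSpace ℝ (Fin n) →L[ℝ] F) :
    (pairing B D)ᵀ = pairing D B := by
  ext i j
  simp [pairing_apply, real_inner_comm]

lemma pairing_self_inv_transpose (D : EuclideanSpace ℝ (Fin n) →L[ℝ] F) :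
    ((pairing D D)⁻¹)ᵀ = (pairing D D)⁻¹ := by
  rw [Matrix.transpose_nonsing_inv, pairing_transpose]

lemma euclidean_eq_sum_single (v : EuclideanSpace ℝ (Fin n)) :
    v = ∑ i, v i • EuclideanSpace.single i (1 : ℝ) := by
  ext j
  simp [Finset.sum_apply, Pi.single_apply]

lemma map_eq_sum_single (D : EuclideanSpace ℝ (Fin n) →L[ℝ] F) (v : EuclideanSpace ℝ (Fin n)) :
    D v = ∑ i, v i • D (EuclideanSpace.single i 1) := by
  conv_lhs => rw [euclidean_eq_sum_single v]
  simp only [map_sum, map_smul]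

lemma det_pairing_self_pos {D : EuclideanSpace ℝ (Fin n) →L[ℝ] F} (hD : Function.Injective D) :
    0 < (pairing D D).det := by
  have hli : LinearIndependent ℝ fun i : Fin n => D (EuclideanSpace.single i (1 : ℝ)) := by
    rw [Fintype.linearIndependent_iff]
    intro g hg i
    have h0 : D (WithLp.toLp 2 g) = D 0 := by
      rw [map_eq_sum_single, map_zero]
      exact hg
    have := congrArg (fun v : EuclideanSpace ℝ (Fin n) => v i) (hD h0)
    simpa using this
  exact (Matrix.posDef_gram_of_linearIndependent hli).det_pos

/-- The matrix of an endomorphism of `ℝⁿ` in the standard basis. -/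
def stdMatrix (A : EuclideanSpace ℝ (Fin n) →L[ℝ] EuclideanSpace ℝ (Fin n)) :
    Matrix (Fin n) (Fin n) ℝ :=
  Matrix.of fun i j => A (EuclideanSpace.single j 1) i

lemma det_stdMatrix (A : EuclideanSpace ℝ (Fin n) →L[ℝ] EuclideanSpace ℝ (Fin n)) :
    (stdMatrix A).det = A.det := by
  rw [ContinuousLinearMap.det,
    ← LinearMap.det_toMatrix (EuclideanSpace.basisFun (Fin n) ℝ).toBasis]
  congr 1

lemma pairing_comp (B D : EuclideanSpace ℝ (Fin n) →L[ℝ] F)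
    (A : EuclideanSpace ℝ (Fin n) →L[ℝ] EuclideanSpace ℝ (Fin n)) :
    pairing (B.comp A) (D.comp A) = (stdMatrix A)ᵀ * pairing B D * stdMatrix A := by
  ext i j
  rw [pairing_apply, ContinuousLinearMap.comp_apply, ContinuousLinearMap.comp_apply,
    map_eq_sum_single B, map_eq_sum_single D]
  simp only [inner_sum, sum_inner, Matrix.mul_apply, Finset.sum_mul, inner_smul_left,
    inner_smul_right, pairing_apply, stdMatrix, Matrix.transpose_apply, Matrix.of_apply]
  refine Finset.sum_congr rfl fun k _ => ?_
  rw [Finset.mul_sum]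
  refine Finset.sum_congr rfl fun l _ => ?_
  simp only [conj_trivial]
  ring

/-- Both matrices change by the congruence `P ↦ Aᵀ P A`, so `G⁻¹ P` is conjugated by `A` and keeps
its trace. This makes the divergence independent of the chart. -/
lemma metricTrace_comp (B D : EuclideanSpace ℝ (Fin n) →L[ℝ] F)
    (A : EuclideanSpace ℝ (Fin n) →L[ℝ] EuclideanSpace ℝ (Fin n)) (hA : A.det ≠ 0) :
    metricTrace (D.comp A) (B.comp A) = metricTrace D B := by
  have hu : IsUnit (stdMatrix A).det := by rw [det_stdMatrix]; exact isUnit_iff_ne_zero.2 hA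
  have hu' : IsUnit (stdMatrix A)ᵀ.det := by rwa [Matrix.det_transpose]
  unfold metricTrace
  rw [pairing_comp, pairing_comp, Matrix.mul_inv_rev, Matrix.mul_inv_rev]
  calc _ = ((stdMatrix A)⁻¹ * ((pairing D D)⁻¹ * (((stdMatrix A)ᵀ⁻¹ * (stdMatrix A)ᵀ) *
        pairing B D) * stdMatrix A)).trace := by simp only [Matrix.mul_assoc]
    _ = _ := by
      rw [Matrix.nonsing_inv_mul _ hu', Matrix.one_mul, Matrix.trace_mul_comm, Matrix.mul_assoc,
        Matrix.mul_nonsing_inv _ hu, Matrix.mul_one]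

lemma sqrt_det_pairing_comp (D : EuclideanSpace ℝ (Fin n) →L[ℝ] F)
    (A : EuclideanSpace ℝ (Fin n) →L[ℝ] EuclideanSpace ℝ (Fin n)) :
    √(pairing (D.comp A) (D.comp A)).det = |A.det| * √(pairing D D).det := by
  rw [pairing_comp, Matrix.det_mul, Matrix.det_mul, Matrix.det_transpose, det_stdMatrix,
    mul_comm, ← mul_assoc, Real.sqrt_mul (mul_self_nonneg _), Real.sqrt_mul_self_eq_abs]

lemma pairing_sum_left {ι : Type*} (s : Finset ι) (B : ι → EuclideanSpace ℝ (Fin n) →L[ℝ] F)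
    (D : EuclideanSpace ℝ (Fin n) →L[ℝ] F) :
    pairing (∑ i ∈ s, B i) D = ∑ i ∈ s, pairing (B i) D := by
  ext i j; simp [pairing_apply, sum_inner, Matrix.sum_apply]

lemma metricTrace_sum {ι : Type*} (s : Finset ι) (B : ι → EuclideanSpace ℝ (Fin n) →L[ℝ] F)
    (D : EuclideanSpace ℝ (Fin n) →L[ℝ] F) :
    metricTrace D (∑ i ∈ s, B i) = ∑ i ∈ s, metricTrace D (B i) := by
  simp [metricTrace, pairing_sum_left, Matrix.mul_sum, Matrix.trace_sum]

lemma metricTrace_zero (D : EuclideanSpace ℝ (Fin n) →L[ℝ] F) : metricTrace D 0 = 0 := by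
  have : pairing 0 D = 0 := by ext i j; simp [pairing_apply]
  simp [metricTrace, this]

end LinearAlgebra

/-! ### Jacobi's formula and the divergence in coordinates. -/

section Calculus

variable {n : ℕ} {F : Type*} [NormedAddCommGroup F] [InnerProductSpace ℝ F]

/-- Jacobi's formula for the derivative of a determinant. -/
lemma hasFDerivAt_det {E : Type*} [NormedAddCommGroup E] [NormedSpace ℝ E]
    {G : E → Matrix (Fin n) (Fin n) ℝ} {G' : Fin n → Fin n → E →L[ℝ] ℝ} {y : E}
    (hG : ∀ i j, HasFDerivAt (fun z => G z i j) (G' i j) y) :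
    HasFDerivAt (fun z => (G z).det) (∑ i, ∑ j, (G y).adjugate j i • G' i j) y := by
  let f : ContinuousMultilinearMap ℝ (fun _ : Fin n => Fin n → ℝ) ℝ :=
    ⟨(Matrix.detRowAlternating (n := Fin n) (R := ℝ)).toMultilinearMap,
      (continuous_id (X := Matrix (Fin n) (Fin n) ℝ)).matrix_det⟩
  have h1 : HasFDerivAt (fun z => (G z : Fin n → Fin n → ℝ))
      (ContinuousLinearMap.pi fun i => ContinuousLinearMap.pi fun j => G' i j) y :=
    hasFDerivAt_pi.2 fun i => hasFDerivAt_pi.2 fun j => hG i j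
  have h2 := (f.hasFDerivAt (G y)).comp y h1
  refine HasFDerivAt.congr_fderiv (f := fun z => (G z).det) h2 (ContinuousLinearMap.ext fun v => ?_)
  have h3 := f.linearDeriv_apply (G y) (fun i j => G' i j v)
  refine Eq.trans h3 ?_
  simp only [_root_.sum_apply, _root_.smul_apply]
  refine Finset.sum_congr rfl fun i _ => ?_
  change (Matrix.updateRow (G y) i (fun j => G' i j v)).det = _
  rw [← Matrix.det_transpose, ← Matrix.updateCol_transpose, ← Matrix.cramer_apply,
    Matrix.cramer_eq_adjugate_mulVec, ← Matrix.adjugate_transpose]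
  simp [Matrix.mulVec, dotProduct]

end Calculus

section Calculus

variable {n : ℕ} {F : Type*} [NormedAddCommGroup F] [InnerProductSpace ℝ F]

/-- The adjugate is `det G • G⁻¹` and is symmetric, so `P` and `Pᵀ` contribute equally. With
Jacobi's formula and `∂G = P + Pᵀ` this gives the derivative of the Gram determinant. -/
lemma trace_adjugate_mul {G P : Matrix (Fin n) (Fin n) ℝ} (hG : Gᵀ = G) (hdet : G.det ≠ 0) :
    ∑ i, ∑ j, G.adjugate j i * (P i j + P j i) = 2 * G.det * (G⁻¹ * P).trace := by
  have h1 : ∑ i, ∑ j, G.adjugate j i * P i j = (G.adjugate * P).trace := by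
    simp only [Matrix.trace, Matrix.diag, Matrix.mul_apply]
    exact Finset.sum_comm
  have h2 : ∑ i, ∑ j, G.adjugate j i * P j i = (G.adjugate * P).trace := by
    have hs : ∀ i j, G.adjugate j i = G.adjugate i j := fun i j => by
      conv_lhs => rw [← hG, ← Matrix.adjugate_transpose, Matrix.transpose_apply]
    simp only [Matrix.trace, Matrix.diag, Matrix.mul_apply, hs]
  have h3 : G.adjugate = G.det • G⁻¹ := by
    rw [Matrix.inv_def, smul_smul, Ring.mul_inverse_cancel _ (isUnit_iff_ne_zero.2 hdet), one_smul]
  simp only [mul_add, Finset.sum_add_distrib]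
  rw [h1, h2, h3, Matrix.smul_mul, Matrix.trace_smul, smul_eq_mul]
  ring

lemma hasFDerivAt_pairing_self {X : EuclideanSpace ℝ (Fin n) → F} {y : EuclideanSpace ℝ (Fin n)}
    (hX : ContDiffAt ℝ 2 X y) (i j : Fin n) :
    ∃ G' : EuclideanSpace ℝ (Fin n) →L[ℝ] ℝ,
      HasFDerivAt (fun z => pairing (fderiv ℝ X z) (fderiv ℝ X z) i j) G' y ∧
      ∀ v, G' v = pairing (fderiv ℝ (fderiv ℝ X) y v) (fderiv ℝ X y) i j +
        pairing (fderiv ℝ (fderiv ℝ X) y v) (fderiv ℝ X y) j i := by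
  have hd : HasFDerivAt (fderiv ℝ X) (fderiv ℝ (fderiv ℝ X) y) y :=
    ((hX.fderiv_right (m := 1) (by norm_num)).differentiableAt one_ne_zero).hasFDerivAt
  have h1 := fun i : Fin n => hd.clm_apply (hasFDerivAt_const (EuclideanSpace.single i (1 : ℝ)) y)
  refine ⟨_, (h1 i).inner ℝ (h1 j), fun v => ?_⟩
  simp [pairing_apply, real_inner_comm, add_comm]

/-- By the product rule, `∂_i W = ∑ (∂_i V^k ∂_k X + V^k ∂_i ∂_k X)`. In the first sum the Gram
matrix cancels and leaves `∑ ∂_k V^k`; in the second, symmetry of second derivatives turns `∂_i ∂_k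
X` into the derivative of `DX` along `e_k`. -/
lemma metricTrace_sum_smul {X W : EuclideanSpace ℝ (Fin n) → F}
    {V : Fin n → EuclideanSpace ℝ (Fin n) → ℝ} {y : EuclideanSpace ℝ (Fin n)}
    (hX : ContDiffAt ℝ 2 X y) (hinj : Function.Injective (fderiv ℝ X y))
    (hV : ∀ j, DifferentiableAt ℝ (V j) y)
    (hW : W =ᶠ[𝓝 y] fun z => ∑ k, V k z • fderiv ℝ X z (EuclideanSpace.single k 1)) :
    metricTrace (fderiv ℝ X y) (fderiv ℝ W y) =
      ∑ k, (fderiv ℝ (V k) y (EuclideanSpace.single k 1) +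
        V k y * metricTrace (fderiv ℝ X y)
          (fderiv ℝ (fderiv ℝ X) y (EuclideanSpace.single k 1))) := by
  have hd : HasFDerivAt (fderiv ℝ X) (fderiv ℝ (fderiv ℝ X) y) y :=
    ((hX.fderiv_right (m := 1) (by norm_num)).differentiableAt one_ne_zero).hasFDerivAt
  have hsymm : IsSymmSndFDerivAt ℝ X y := hX.isSymmSndFDerivAt (by simp)
  have h1 := fun i : Fin n => hd.clm_apply (hasFDerivAt_const (EuclideanSpace.single i (1 : ℝ)) y)
  have h2 := HasFDerivAt.fun_sum (u := Finset.univ) fun k _ => (hV k).hasFDerivAt.smul (h1 k)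
  have hW' := (h2.congr_of_eventuallyEq hW).fderiv
  have hdet : IsUnit (pairing (fderiv ℝ X y) (fderiv ℝ X y)).det :=
    isUnit_iff_ne_zero.2 (det_pairing_self_pos hinj).ne'
  set D := fderiv ℝ X y with hD
  set M : Matrix (Fin n) (Fin n) ℝ := Matrix.of fun i k =>
    fderiv ℝ (V k) y (EuclideanSpace.single i 1) with hM
  have hP : pairing (fderiv ℝ W y) D = M * pairing D D +
      ∑ k, V k y • pairing (fderiv ℝ (fderiv ℝ X) y (EuclideanSpace.single k 1)) D := by
    ext i j
    rw [hW', Matrix.add_apply, Matrix.mul_apply, Matrix.sum_apply, ← Finset.sum_add_distrib,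
      pairing_apply]
    simp only [_root_.sum_apply, sum_inner]
    refine Finset.sum_congr rfl fun k _ => ?_
    simp [inner_add_left, inner_smul_left, pairing_apply, hM, add_comm,
      hsymm (EuclideanSpace.single k 1) (EuclideanSpace.single i 1)]
  rw [metricTrace, hP, Matrix.mul_add, Matrix.trace_add, Matrix.trace_mul_comm, Matrix.mul_assoc,
    Matrix.mul_nonsing_inv _ hdet, Matrix.mul_one, Matrix.mul_sum, Matrix.trace_sum,
    Finset.sum_add_distrib]
  congr 1
  refine Finset.sum_congr rfl fun k _ => ?_
  rw [Matrix.mul_smul, Matrix.trace_smul, smul_eq_mul, metricTrace]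

/-- By Jacobi's formula `∂_j √g` is `√g` times the metric trace of `∂_j DX`, which is the second
term in `metricTrace_sum_smul`. -/
lemma sum_fderiv_sqrt_det_mul {X W : EuclideanSpace ℝ (Fin n) → F}
    {V : Fin n → EuclideanSpace ℝ (Fin n) → ℝ} {y : EuclideanSpace ℝ (Fin n)}
    (hX : ContDiffAt ℝ 2 X y) (hinj : Function.Injective (fderiv ℝ X y))
    (hV : ∀ j, DifferentiableAt ℝ (V j) y)
    (hW : W =ᶠ[𝓝 y] fun z => ∑ k, V k z • fderiv ℝ X z (EuclideanSpace.single k 1)) :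
    ∑ j, fderiv ℝ (fun z => √(pairing (fderiv ℝ X z) (fderiv ℝ X z)).det * V j z) y
        (EuclideanSpace.single j 1) =
      √(pairing (fderiv ℝ X y) (fderiv ℝ X y)).det *
        metricTrace (fderiv ℝ X y) (fderiv ℝ W y) := by
  choose G' hG' hG'v using hasFDerivAt_pairing_self hX
  have hpos := det_pairing_self_pos hinj
  have hs := (hasFDerivAt_det hG').sqrt hpos.ne'
  rw [metricTrace_sum_smul hX hinj hV hW, Finset.mul_sum]
  refine Finset.sum_congr rfl fun j _ => ?_
  rw [(hs.fun_mul (hV j).hasFDerivAt).fderiv]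
  simp only [_root_.add_apply, _root_.smul_apply, _root_.sum_apply, hG'v, smul_eq_mul]
  rw [trace_adjugate_mul (pairing_transpose _ _) hpos.ne', metricTrace]
  have h2 := Real.sq_sqrt hpos.le
  have h3 : √(pairing (fderiv ℝ X y) (fderiv ℝ X y)).det ≠ 0 := (Real.sqrt_pos.2 hpos).ne'
  set s := √(pairing (fderiv ℝ X y) (fderiv ℝ X y)).det
  rw [← h2]
  field_simp

end Calculus

/-! ### The divergence theorem on the half-space. -/

section HalfSpace

lemma isClosed_halfSpace (n : ℕ) [NeZero n] :
    IsClosed {y : EuclideanSpace ℝ (Fin n) | 0 ≤ y 0} :=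
  isClosed_le continuous_const (by fun_prop)

lemma uniqueDiffOn_halfSpace (n : ℕ) [NeZero n] :
    UniqueDiffOn ℝ {y : EuclideanSpace ℝ (Fin n) | 0 ≤ y 0} := by
  rw [← range_modelWithCornersEuclideanHalfSpace]
  exact (𝓡∂ n).uniqueDiffOn

/-- The divergence theorem on the half-space, for a compactly supported vector field tangent to the
boundary. -/
lemma setIntegral_halfSpace_divergence_eq_zero {n : ℕ} [NeZero n]
    {f : Fin n → EuclideanSpace ℝ (Fin n) → ℝ} {K : Set (EuclideanSpace ℝ (Fin n))}
    (hK : IsCompact K) (hf : ∀ j, ContDiffOn ℝ 1 (f j) {y | 0 ≤ y 0})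
    (hfK : ∀ j y, 0 ≤ y 0 → y ∉ K → f j y = 0) (hf0 : ∀ y, y 0 = 0 → f 0 y = 0) :
    ∫ y in {y : EuclideanSpace ℝ (Fin n) | 0 ≤ y 0},
      ∑ j, fderivWithin ℝ (f j) {y | 0 ≤ y 0} y (EuclideanSpace.single j 1) = 0 := by
  obtain ⟨m, rfl⟩ := Nat.exists_eq_succ_of_ne_zero (NeZero.ne n)
  set S : Set (EuclideanSpace ℝ (Fin (m + 1))) := {y | 0 ≤ y 0} with hS
  obtain ⟨R, hR0, hR⟩ : ∃ R : ℝ, 0 < R ∧ ∀ y ∈ K, ∀ i, |y i| < R := by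
    obtain ⟨R, hR⟩ := hK.isBounded.exists_norm_le
    refine ⟨max R 0 + 1, by positivity, fun y hy i => ?_⟩
    have h1 : |y i| ≤ ‖y‖ := by simpa using PiLp.norm_apply_le y i
    have h2 := hR y hy
    have h3 := le_max_left R 0
    linarith
  have hfd : ∀ j, ContinuousOn (fderivWithin ℝ (f j) S) S := fun j =>
    (hf j).continuousOn_fderivWithin (uniqueDiffOn_halfSpace _) le_rfl
  have hzero : ∀ j, ∀ y ∈ S, y ∉ K → fderivWithin ℝ (f j) S y = 0 := fun j y hy hyK => by
    have h : f j =ᶠ[𝓝[S] y] fun _ => 0 := by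
      filter_upwards [self_mem_nhdsWithin,
        mem_nhdsWithin_of_mem_nhds (hK.isClosed.isOpen_compl.mem_nhds hyK)] with z hz hz'
      exact hfK j z hz hz'
    rw [h.fderivWithin_eq (hfK j y hy hyK), fderivWithin_const_apply]
  -- In direction `0` the box starts on the boundary of the half-space; every other face has a
  -- coordinate of absolute value `R` and so misses `K`.
  set a : Fin (m + 1) → ℝ := fun i => if i = 0 then 0 else -R with ha
  set b : Fin (m + 1) → ℝ := fun _ => R with hb
  have hab : a ≤ b := fun i => by
    simp only [ha, hb]; split_ifs <;> linarith
  set L := (PiLp.continuousLinearEquiv 2 ℝ fun _ : Fin (m + 1) => ℝ).symm with hL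
  have hLapp : ∀ v i, (L v) i = v i := fun v i => rfl
  have hbox : MapsTo L (Icc a b) S := fun v hv => by
    have := hv.1 0
    simpa [ha, hS, hLapp] using this
  have key := integral_divergence_of_hasFDerivAt_off_countable (a := a) (b := b) hab
    (fun v i => f i (L v))
    (fun v => ContinuousLinearMap.pi fun i => (fderivWithin ℝ (f i) S (L v)).comp
      (L : (Fin (m + 1) → ℝ) →L[ℝ] EuclideanSpace ℝ (Fin (m + 1)))) ∅ countable_empty
    (continuousOn_pi.2 fun i => (hf i).continuousOn.comp L.continuous.continuousOn hbox)
    (fun v hv => hasFDerivAt_pi.2 fun i => by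
      have hv0 : S ∈ 𝓝 (L v) := by
        refine mem_of_superset (IsOpen.mem_nhds (isOpen_lt continuous_const
          (by fun_prop : Continuous fun y : EuclideanSpace ℝ (Fin (m + 1)) => y 0))
          (?_ : (0 : ℝ) < (L v) 0)) fun y (hy : (0 : ℝ) < y 0) => hy.le
        have := (hv.1 0 (mem_univ _)).1
        simpa [ha, hLapp] using this
      exact ((((hf i).differentiableOn one_ne_zero _ (mem_of_mem_nhds hv0)).hasFDerivWithinAt
        ).hasFDerivAt hv0).comp v L.hasFDerivAt)
    (by
      refine ContinuousOn.integrableOn_compact isCompact_Icc ?_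
      refine continuousOn_finsetSum _ fun i _ => ?_
      exact ((hfd i).comp L.continuous.continuousOn hbox).clm_apply continuousOn_const)
  have hface : ∀ (i : Fin (m + 1)) (c : ℝ), c ∈ Icc (a i) (b i) →
      ∀ v ∈ Icc (a ∘ i.succAbove) (b ∘ i.succAbove), i.insertNth c v ∈ Icc a b := by
    intro i c hc v hv
    simp only [mem_Icc, Pi.le_def] at hv ⊢
    constructor <;> intro k <;> refine i.succAboveCases ?_ (fun l => ?_) k
    all_goals simp
    exacts [hc.1, hv.1 l, hc.2, hv.2 l]
  -- All face integrals vanish: by tangency on the lower face in direction `0`, and because the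
  -- field is zero off `K` on the others.
  have hright : ∀ i : Fin (m + 1),
      ((∫ v in Icc (a ∘ i.succAbove) (b ∘ i.succAbove), f i (L (i.insertNth (b i) v))) -
        ∫ v in Icc (a ∘ i.succAbove) (b ∘ i.succAbove), f i (L (i.insertNth (a i) v))) = 0 := by
    intro i
    rw [setIntegral_eq_zero_of_forall_eq_zero, setIntegral_eq_zero_of_forall_eq_zero, sub_zero]
    · intro v hv
      have hmem := hbox (hface i (a i) ⟨le_rfl, hab i⟩ v hv)
      by_cases hi : i = 0
      · subst hi
        exact hf0 _ (by simp [hLapp, ha])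
      · refine hfK i _ hmem fun hk => ?_
        have := hR _ hk i
        simp [hLapp, ha, hi, abs_of_pos hR0] at this
    · intro v hv
      have hmem := hbox (hface i (b i) ⟨hab i, le_rfl⟩ v hv)
      refine hfK i _ hmem fun hk => ?_
      have := hR _ hk i
      simp [hLapp, hb, abs_of_pos hR0] at this
  have hKbox : K ∩ S ⊆ L '' Icc a b := by
    rintro y ⟨hy, hyS⟩
    refine ⟨L.symm y, ?_, L.apply_symm_apply y⟩
    have hy' := hR y hy
    constructor <;> intro i <;> have h1 := abs_lt.1 (hy' i)
    · change a i ≤ y i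
      simp only [ha]; split_ifs with h
      · subst h; exact hyS
      · exact h1.1.le
    · exact h1.2.le
  have hmp := PiLp.volume_preserving_toLp (Fin (m + 1))
  have hemb : MeasurableEmbedding (WithLp.toLp 2 : (Fin (m + 1) → ℝ) → _) :=
    (MeasurableEquiv.toLp 2 (Fin (m + 1) → ℝ)).measurableEmbedding
  refine (setIntegral_eq_of_subset_of_forall_sdiff_eq_zero (s := L '' Icc a b) (t := S)
    (isClosed_halfSpace _).measurableSet hbox.image_subset ?_).trans ?_
  · rintro y ⟨hyS, hy⟩
    refine Finset.sum_eq_zero fun j _ => ?_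
    rw [hzero j y hyS fun h => hy (hKbox ⟨h, hyS⟩)]
    rfl
  · have := hmp.setIntegral_image_emb hemb (fun y => ∑ j, fderivWithin ℝ (f j) S y
      (EuclideanSpace.single j 1)) (Icc a b)
    refine Eq.trans this (Eq.trans ?_ (key.trans (Finset.sum_eq_zero fun i _ => hright i)))
    rfl

end HalfSpace

/-! ### Smooth dependence of determinants, inverses and metric traces. -/

section MatrixSmoothness

variable {n : ℕ} {E : Type*} [NormedAddCommGroup E] [NormedSpace ℝ E] {k : WithTop ℕ∞}
  {G : E → Matrix (Fin n) (Fin n) ℝ} {s : Set E} {y : E}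

lemma contDiffWithinAt_matrix_det (hG : ∀ i j, ContDiffWithinAt ℝ k (fun z => G z i j) s y) :
    ContDiffWithinAt ℝ k (fun z => (G z).det) s y := by
  simp only [Matrix.det_apply']
  exact ContDiffWithinAt.sum fun σ _ => contDiffWithinAt_const.mul
    (contDiffWithinAt_prod fun i _ => hG _ _)

lemma contDiffWithinAt_matrix_inv (hG : ∀ i j, ContDiffWithinAt ℝ k (fun z => G z i j) s y)
    (hy : (G y).det ≠ 0) (i j : Fin n) :
    ContDiffWithinAt ℝ k (fun z => (G z)⁻¹ i j) s y := by
  -- Cramer's rule writes each entry of the inverse as a quotient of determinants.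
  have h1 : (fun z => (G z)⁻¹ i j) =
      fun z => ((G z).det)⁻¹ * ((G z).updateRow j (Pi.single i 1)).det := by
    ext z
    rw [Matrix.inv_def, Ring.inverse_eq_inv', Matrix.smul_apply, Matrix.adjugate_apply, smul_eq_mul]
  rw [h1]
  refine ((contDiffWithinAt_matrix_det hG).inv hy).mul (contDiffWithinAt_matrix_det fun a b => ?_)
  by_cases ha : a = j
  · subst ha
    simpa using contDiffWithinAt_const
  · simpa [Matrix.updateRow_ne ha] using hG a b

variable {F : Type*} [NormedAddCommGroup F] [InnerProductSpace ℝ F]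
  {B D : E → EuclideanSpace ℝ (Fin n) →L[ℝ] F}

lemma contDiffWithinAt_pairing (hB : ContDiffWithinAt ℝ k B s y) (hD : ContDiffWithinAt ℝ k D s y)
    (i j : Fin n) : ContDiffWithinAt ℝ k (fun z => pairing (B z) (D z) i j) s y := by
  simp only [pairing_apply]
  exact (hB.clm_apply contDiffWithinAt_const).inner ℝ (hD.clm_apply contDiffWithinAt_const)

lemma contDiffWithinAt_metricTrace (hB : ContDiffWithinAt ℝ k B s y)
    (hD : ContDiffWithinAt ℝ k D s y) (hy : Function.Injective (D y)) :
    ContDiffWithinAt ℝ k (fun z => metricTrace (D z) (B z)) s y := by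
  simp only [metricTrace, Matrix.trace, Matrix.diag, Matrix.mul_apply]
  exact ContDiffWithinAt.sum fun i _ => ContDiffWithinAt.sum fun j _ =>
    (contDiffWithinAt_matrix_inv (contDiffWithinAt_pairing hD hD) (det_pairing_self_pos hy).ne' _ _
      ).mul (contDiffWithinAt_pairing hB hD _ _)

lemma contDiffWithinAt_sqrt_det_pairing (hD : ContDiffWithinAt ℝ k D s y)
    (hy : Function.Injective (D y)) :
    ContDiffWithinAt ℝ k (fun z => √(pairing (D z) (D z)).det) s y :=
  (contDiffWithinAt_matrix_det (contDiffWithinAt_pairing hD hD)).sqrt (det_pairing_self_pos hy).ne'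

end MatrixSmoothness

/-! ### Differentials and divergence in a fixed chart. -/

section Charts

variable {n : ℕ} [NeZero n] {M : Type*} [TopologicalSpace M] [ChartedSpace (EuclideanHalfSpace n) M]

/-- The differential of `f` in the coordinates of the preferred chart at `p`. -/
def coordDiff (f : M → EuclideanSpace ℝ (Fin (n + 1))) (p : M) (y : EuclideanSpace ℝ (Fin n)) :
    EuclideanSpace ℝ (Fin n) →L[ℝ] EuclideanSpace ℝ (Fin (n + 1)) :=
  fderivWithin ℝ (f ∘ (extChartAt (𝓡∂ n) p).symm) (range (𝓡∂ n)) y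

/-- The divergence along the immersion `x` of the vector field `W` along `x`. -/
def divergence (x W : M → EuclideanSpace ℝ (Fin (n + 1))) (q : M) : ℝ :=
  metricTrace (diff x q) (diff W q)

lemma meanCurvature_eq_divergence (x ν : M → EuclideanSpace ℝ (Fin (n + 1))) (q : M) :
    meanCurvature x ν q = divergence x ν q := rfl

lemma chartDensity_eq (x : M → EuclideanSpace ℝ (Fin (n + 1))) (p : M)
    (y : EuclideanSpace ℝ (Fin n)) :
    chartDensity x p y = √(pairing (coordDiff x p y) (coordDiff x p y)).det := rfl

variable {f : M → EuclideanSpace ℝ (Fin (n + 1))}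

lemma diff_eq_coordDiff (hf : ContMDiff (𝓡∂ n) 𝓘(ℝ, EuclideanSpace ℝ (Fin (n + 1))) ∞ f) (q : M) :
    diff f q = coordDiff f q (extChartAt (𝓡∂ n) q q) := by
  exact (hf.mdifferentiableAt (by simp)).mfderiv

variable [IsManifold (𝓡∂ n) ∞ M]

lemma contDiffWithinAt_comp_extChartAt_symm
    (hf : ContMDiff (𝓡∂ n) 𝓘(ℝ, EuclideanSpace ℝ (Fin (n + 1))) ∞ f) {p : M}
    {y : EuclideanSpace ℝ (Fin n)} (hy : y ∈ (extChartAt (𝓡∂ n) p).target) :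
    ContDiffWithinAt ℝ ∞ (f ∘ (extChartAt (𝓡∂ n) p).symm) (range (𝓡∂ n)) y := by
  have h := (hf.comp_contMDiffOn (contMDiffOn_extChartAt_symm (I := 𝓡∂ n) (n := ∞) p)) y hy
  exact (contMDiffWithinAt_iff_contDiffWithinAt.1 h).mono_of_mem_nhdsWithin
    (extChartAt_target_mem_nhdsWithin_of_mem hy)

lemma contDiffWithinAt_coordDiff
    (hf : ContMDiff (𝓡∂ n) 𝓘(ℝ, EuclideanSpace ℝ (Fin (n + 1))) ∞ f) {p : M}
    {y : EuclideanSpace ℝ (Fin n)} (hy : y ∈ (extChartAt (𝓡∂ n) p).target) :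
    ContDiffWithinAt ℝ ∞ (coordDiff f p) (range (𝓡∂ n)) y :=
  (contDiffWithinAt_comp_extChartAt_symm hf hy).fderivWithin_right (𝓡∂ n).uniqueDiffOn le_rfl
    (extChartAt_target_subset_range p hy)

/-- The chain rule for the transition map, with derivatives taken within the half-space so that
boundary points are covered. -/
lemma coordDiff_change (hf : ContMDiff (𝓡∂ n) 𝓘(ℝ, EuclideanSpace ℝ (Fin (n + 1))) ∞ f)
    {p p' q : M} (hq : q ∈ (extChartAt (𝓡∂ n) p).source)
    (hq' : q ∈ (extChartAt (𝓡∂ n) p').source) :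
    coordDiff f p (extChartAt (𝓡∂ n) p q) =
      (coordDiff f p' (extChartAt (𝓡∂ n) p' q)).comp (tangentCoordChange (𝓡∂ n) p p' q) := by
  have : IsManifold (𝓡∂ n) 1 M := IsManifold.of_le (n := ∞) (by simp)
  set φ := extChartAt (𝓡∂ n) p
  set ψ := extChartAt (𝓡∂ n) p'
  have hτ := hasFDerivWithinAt_tangentCoordChange (I := 𝓡∂ n) ⟨hq, hq'⟩
  have hqq : (ψ ∘ φ.symm) (φ q) = ψ q := by
    rw [Function.comp_apply, φ.left_inv hq]
  have hfψ : HasFDerivWithinAt (f ∘ ψ.symm) (coordDiff f p' (ψ q)) (range (𝓡∂ n))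
      ((ψ ∘ φ.symm) (φ q)) := by
    rw [hqq]
    exact ((contDiffWithinAt_comp_extChartAt_symm hf (ψ.map_source hq')).differentiableWithinAt
      (by simp)).hasFDerivWithinAt
  have hcomp := hfψ.comp _ hτ fun y _ => by
    simp only [ψ, Function.comp_apply, extChartAt, OpenPartialHomeomorph.extend,
      PartialEquiv.coe_trans, ModelWithCorners.toPartialEquiv_coe]
    exact mem_range_self _
  have hev : f ∘ φ.symm =ᶠ[𝓝[range (𝓡∂ n)] (φ q)] (f ∘ ψ.symm) ∘ (ψ ∘ φ.symm) := by
    have h1 : φ.symm ⁻¹' ψ.source ∈ 𝓝[range (𝓡∂ n)] (φ q) := by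
      refine (continuousAt_extChartAt_symm' hq).continuousWithinAt ?_
      rw [φ.left_inv hq]
      exact extChartAt_source_mem_nhds' hq'
    filter_upwards [h1] with y hy
    simp [ψ.left_inv hy]
  have hmem := extChartAt_target_subset_range p (φ.map_source hq)
  exact (hev.fderivWithin_eq_of_mem hmem).trans (hcomp.fderivWithin ((𝓡∂ n).uniqueDiffOn _ hmem))

lemma det_tangentCoordChange_ne_zero {p p' q : M} (hq : q ∈ (extChartAt (𝓡∂ n) p).source)
    (hq' : q ∈ (extChartAt (𝓡∂ n) p').source) :
    (tangentCoordChange (𝓡∂ n) p p' q).det ≠ 0 := by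
  have : IsManifold (𝓡∂ n) 1 M := IsManifold.of_le (n := ∞) (by simp)
  have h : (tangentCoordChange (𝓡∂ n) p' p q).comp (tangentCoordChange (𝓡∂ n) p p' q) =
      ContinuousLinearMap.id ℝ _ := by
    ext1 v
    rw [ContinuousLinearMap.comp_apply, tangentCoordChange_comp ⟨⟨hq, hq'⟩, hq⟩,
      tangentCoordChange_self hq]
    rfl
  intro h0
  have h2 := congrArg (fun A : _ →L[ℝ] _ => LinearMap.det (A : EuclideanSpace ℝ (Fin n) →ₗ[ℝ] _)) h
  have h3 := LinearMap.det_comp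
    (tangentCoordChange (𝓡∂ n) p' p q : EuclideanSpace ℝ (Fin n) →ₗ[ℝ] _)
    (tangentCoordChange (𝓡∂ n) p p' q : EuclideanSpace ℝ (Fin n) →ₗ[ℝ] _)
  have h4 : (1 : ℝ) = 0 := by
    rw [← LinearMap.det_id (M := EuclideanSpace ℝ (Fin n))]
    refine (Eq.trans h3.symm h2).symm.trans ?_
    exact mul_eq_zero_of_right _ h0
  exact one_ne_zero h4

variable {x W : M → EuclideanSpace ℝ (Fin (n + 1))}

lemma coordDiff_injective (hx : IsSmoothImmersion x) {p q : M}
    (hq : q ∈ (extChartAt (𝓡∂ n) p).source) :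
    Function.Injective (coordDiff x p (extChartAt (𝓡∂ n) p q)) := by
  have h := hx.injective_diff q
  rw [diff_eq_coordDiff hx.smooth, coordDiff_change hx.smooth (mem_extChartAt_source q) hq] at h
  have hs : Function.Surjective (tangentCoordChange (𝓡∂ n) q p q) := by
    have := LinearEquiv.surjective (LinearMap.equivOfDetNeZero _
      (det_tangentCoordChange_ne_zero (mem_extChartAt_source (I := 𝓡∂ n) q) hq))
    exact this
  exact Function.Injective.of_comp_right h hs

/-- The definition of `divergence` uses the preferred chart at `q`, which may jump as `q` moves.
This form uses one chart for all nearby points, as regularity and integration require. -/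
lemma divergence_eq_metricTrace_coordDiff (hx : IsSmoothImmersion x)
    (hW : ContMDiff (𝓡∂ n) 𝓘(ℝ, EuclideanSpace ℝ (Fin (n + 1))) ∞ W) {p q : M}
    (hq : q ∈ (extChartAt (𝓡∂ n) p).source) :
    divergence x W q = metricTrace (coordDiff x p (extChartAt (𝓡∂ n) p q))
      (coordDiff W p (extChartAt (𝓡∂ n) p q)) := by
  rw [divergence, diff_eq_coordDiff hx.smooth, diff_eq_coordDiff hW,
    coordDiff_change hx.smooth (mem_extChartAt_source q) hq,
    coordDiff_change hW (mem_extChartAt_source q) hq, metricTrace_comp]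
  exact det_tangentCoordChange_ne_zero (mem_extChartAt_source q) hq

lemma continuous_divergence (hx : IsSmoothImmersion x)
    (hW : ContMDiff (𝓡∂ n) 𝓘(ℝ, EuclideanSpace ℝ (Fin (n + 1))) ∞ W) :
    Continuous (divergence x W) := by
  refine continuous_iff_continuousAt.2 fun p => ?_
  have hp := mem_extChartAt_target (I := 𝓡∂ n) p
  have h1 := (contDiffWithinAt_metricTrace (contDiffWithinAt_coordDiff hW hp)
    (contDiffWithinAt_coordDiff hx.smooth hp)
    (coordDiff_injective hx (mem_extChartAt_source p))).continuousWithinAt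
  have h2 : Tendsto (extChartAt (𝓡∂ n) p) (𝓝 p)
      (𝓝[range (𝓡∂ n)] (extChartAt (𝓡∂ n) p p)) := by
    refine tendsto_nhdsWithin_iff.2 ⟨continuousAt_extChartAt p, ?_⟩
    filter_upwards [extChartAt_source_mem_nhds (I := 𝓡∂ n) p] with q hq
    exact extChartAt_target_subset_range p ((extChartAt (𝓡∂ n) p).map_source hq)
  have h3 := Tendsto.comp h1 h2
  have h4 := divergence_eq_metricTrace_coordDiff hx hW (mem_extChartAt_source (I := 𝓡∂ n) p)
  rw [ContinuousAt, h4]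
  refine h3.congr' ?_
  filter_upwards [extChartAt_source_mem_nhds (I := 𝓡∂ n) p] with q hq
  exact (divergence_eq_metricTrace_coordDiff hx hW hq).symm

lemma continuousOn_chartDensity (hx : IsSmoothImmersion x) (p : M) :
    ContinuousOn (chartDensity x p) (extChartAt (𝓡∂ n) p).target := by
  intro y hy
  have hinj := coordDiff_injective hx ((extChartAt (𝓡∂ n) p).map_target hy)
  rw [(extChartAt (𝓡∂ n) p).right_inv hy] at hinj
  exact (contDiffWithinAt_sqrt_det_pairing (contDiffWithinAt_coordDiff hx.smooth hy)
    hinj).continuousWithinAt.mono (extChartAt_target_subset_range p)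

end Charts

/-! ### The area measure in charts and its finiteness. -/

section Area

variable {n : ℕ} [NeZero n] {M : Type*} [TopologicalSpace M] [ChartedSpace (EuclideanHalfSpace n) M]

lemma range_eq_halfSpace (n : ℕ) [NeZero n] :
    range (𝓡∂ n) = {y : EuclideanSpace ℝ (Fin n) | 0 ≤ y 0} :=
  range_modelWithCornersEuclideanHalfSpace n

lemma measurableSet_extChartAt_target (p : M) : MeasurableSet (extChartAt (𝓡∂ n) p).target := by
  rw [extChartAt_target]
  refine MeasurableSet.inter ?_ ?_
  · exact ((chartAt (EuclideanHalfSpace n) p).open_target.preimage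
      (𝓡∂ n).continuous_symm).measurableSet
  · rw [range_eq_halfSpace]
    exact (isClosed_halfSpace n).measurableSet

variable [MeasurableSpace M] [BorelSpace M]

lemma measurableSet_preimage_symm_inter_target (p : M) {s : Set M} (hs : MeasurableSet s) :
    MeasurableSet ((extChartAt (𝓡∂ n) p).symm ⁻¹' s ∩ (extChartAt (𝓡∂ n) p).target) := by
  have h := (continuousOn_iff_continuous_domRestrict.1
    (continuousOn_extChartAt_symm (I := 𝓡∂ n) p)).measurable hs
  have h2 := (measurableSet_extChartAt_target (n := n) p).subtype_image h
  rwa [Set.domRestrict_eq, preimage_comp, Subtype.image_preimage_coe, inter_comm] at h2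

lemma measurableSet_extChartAt_source (p : M) : MeasurableSet (extChartAt (𝓡∂ n) p).source :=
  (isOpen_extChartAt_source p).measurableSet

lemma aemeasurable_extChartAt_symm (p : M) (ρ : EuclideanSpace ℝ (Fin n) → ENNReal) :
    AEMeasurable (extChartAt (𝓡∂ n) p).symm
      ((volume.restrict (extChartAt (𝓡∂ n) p).target).withDensity ρ) :=
  ((continuousOn_extChartAt_symm p).aemeasurable (measurableSet_extChartAt_target p)).mono_ac
    (withDensity_absolutelyContinuous _ _)

variable {x : M → EuclideanSpace ℝ (Fin (n + 1))}

lemma chartArea_apply (p : M) {s : Set M} (hs : MeasurableSet s) :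
    chartArea x p s = ∫⁻ y in (extChartAt (𝓡∂ n) p).symm ⁻¹' s ∩ (extChartAt (𝓡∂ n) p).target,
      ENNReal.ofReal (chartDensity x p y) := by
  rw [chartArea, Measure.map_apply_of_aemeasurable (aemeasurable_extChartAt_symm p _) hs,
    withDensity_apply', Measure.restrict_restrict' (measurableSet_extChartAt_target p)]

lemma chartArea_inter_source (p : M) {s : Set M} (hs : MeasurableSet s) :
    chartArea x p (s ∩ (extChartAt (𝓡∂ n) p).source) = chartArea x p s := by
  rw [chartArea_apply p hs, chartArea_apply p (hs.inter (measurableSet_extChartAt_source p))]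
  congr 2
  ext y
  constructor
  · exact fun h => ⟨h.1.1, h.2⟩
  · exact fun h => ⟨⟨h.1, (extChartAt (𝓡∂ n) p).map_target h.2⟩, h.2⟩

variable [IsManifold (𝓡∂ n) ∞ M]

/-- Change of variables along the transition map: the Jacobian `|det|` is the factor by which `√g`
changes in `sqrt_det_pairing_comp`. -/
lemma chartArea_eq_of_subset (hx : IsSmoothImmersion x) {p p' : M} {s : Set M}
    (hs : MeasurableSet s) (hsp : s ⊆ (extChartAt (𝓡∂ n) p).source)
    (hsp' : s ⊆ (extChartAt (𝓡∂ n) p').source) : chartArea x p s = chartArea x p' s := by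
  have : IsManifold (𝓡∂ n) 1 M := IsManifold.of_le (n := ∞) (by simp)
  rw [chartArea_apply p hs, chartArea_apply p' hs]
  set φ := extChartAt (𝓡∂ n) p with hφ
  set ψ := extChartAt (𝓡∂ n) p' with hψ
  set A := φ.symm ⁻¹' s ∩ φ.target with hA
  have himg : ψ.symm ⁻¹' s ∩ ψ.target = (ψ ∘ φ.symm) '' A := by
    ext y
    constructor
    · rintro ⟨h1, h2⟩
      refine ⟨φ (ψ.symm y), ⟨?_, φ.map_source (hsp h1)⟩, ?_⟩
      · rw [mem_preimage, φ.left_inv (hsp h1)]; exact h1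
      · rw [Function.comp_apply, φ.left_inv (hsp h1), ψ.right_inv h2]
    · rintro ⟨z, ⟨h1, h2⟩, rfl⟩
      refine ⟨?_, ψ.map_source (hsp' h1)⟩
      rw [mem_preimage, Function.comp_apply, ψ.left_inv (hsp' h1)]; exact h1
  have hinj : InjOn (ψ ∘ φ.symm) A := by
    rintro y ⟨hy, hyt⟩ z ⟨hz, hzt⟩ hyz
    exact φ.symm.injOn hyt hzt (ψ.injOn (hsp' hy) (hsp' hz) hyz)
  have hderiv : ∀ y ∈ A, HasFDerivWithinAt (ψ ∘ φ.symm)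
      (tangentCoordChange (𝓡∂ n) p p' (φ.symm y)) A y := by
    rintro y ⟨hy, hyt⟩
    have h := hasFDerivWithinAt_tangentCoordChange (I := 𝓡∂ n) ⟨hsp hy, hsp' hy⟩
    rw [← hφ, φ.right_inv hyt] at h
    exact h.mono fun z hz => extChartAt_target_subset_range p hz.2
  rw [himg, lintegral_image_eq_lintegral_abs_det_fderiv_mul volume
    (measurableSet_preimage_symm_inter_target p hs) hderiv hinj]
  refine setLIntegral_congr_fun (measurableSet_preimage_symm_inter_target p hs) ?_
  rintro y ⟨hy, hyt⟩
  dsimp only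
  rw [← ENNReal.ofReal_mul (abs_nonneg _)]
  congr 1
  have h := coordDiff_change hx.smooth (hsp hy) (hsp' hy)
  rw [← hφ, φ.right_inv hyt] at h
  rw [chartDensity_eq, chartDensity_eq, h, sqrt_det_pairing_comp]
  rfl

lemma area_restrict_source (hx : IsSmoothImmersion x) (p : M) :
    (area x).restrict (extChartAt (𝓡∂ n) p).source = chartArea x p := by
  set U := (extChartAt (𝓡∂ n) p).source with hU
  have hUm : MeasurableSet U := measurableSet_extChartAt_source p
  -- The right-hand side bounds every `chartArea x q`: inside `U` the measures of the two charts
  -- agree on the overlap, and outside `U` each is at most the supremum. Hence it bounds the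
  -- supremum, and restricting to `U` removes the second summand.
  have hle : area x ≤ chartArea x p + (area x).restrict Uᶜ := by
    refine iSup_le fun q => Measure.le_iff.2 fun s hs => ?_
    rw [Measure.add_apply, Measure.restrict_apply hs,
      ← measure_inter_add_sdiff s hUm (μ := chartArea x q), Set.sdiff_eq]
    refine add_le_add ?_ ((le_iSup (chartArea x) q : chartArea x q ≤ area x) _)
    rw [← chartArea_inter_source q (hs.inter hUm), chartArea_eq_of_subset hx
      ((hs.inter hUm).inter (measurableSet_extChartAt_source q)) inter_subset_right
      (inter_subset_left.trans inter_subset_right)]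
    exact measure_mono (inter_subset_left.trans inter_subset_left)
  refine le_antisymm (Measure.le_iff.2 fun s hs => ?_) (Measure.le_iff.2 fun s hs => ?_)
  · rw [Measure.restrict_apply hs]
    refine (hle _).trans ?_
    rw [Measure.add_apply, Measure.restrict_apply (hs.inter hUm), inter_assoc, inter_compl_self,
      inter_empty, measure_empty, add_zero]
    exact measure_mono inter_subset_left
  · rw [Measure.restrict_apply hs, ← chartArea_inter_source p hs]
    exact (le_iSup (chartArea x) p : chartArea x p ≤ area x) _

lemma integral_area_eq_setIntegral (hx : IsSmoothImmersion x) (p : M) {f : M → ℝ}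
    (hf : Continuous f) (hfp : ∀ q ∉ (extChartAt (𝓡∂ n) p).source, f q = 0) :
    ∫ q, f q ∂(area x) = ∫ y in (extChartAt (𝓡∂ n) p).target,
      chartDensity x p y * f ((extChartAt (𝓡∂ n) p).symm y) := by
  rw [← setIntegral_eq_integral_of_forall_compl_eq_zero hfp, area_restrict_source hx p, chartArea,
    integral_map (aemeasurable_extChartAt_symm p _) hf.aestronglyMeasurable,
    integral_withDensity_eq_integral_toReal_smul₀
      (((continuousOn_chartDensity hx p).aemeasurable
        (measurableSet_extChartAt_target p)).ennreal_ofReal) (by simp)]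
  refine integral_congr_ae (Eventually.of_forall fun y => ?_)
  have h : 0 ≤ chartDensity x p y := Real.sqrt_nonneg _
  dsimp only
  rw [ENNReal.toReal_ofReal h, smul_eq_mul]

/-- Near each point the density is bounded and the coordinates stay in a ball, so the area is
locally finite; compactness does the rest. -/
lemma isFiniteMeasure_area [CompactSpace M] (hx : IsSmoothImmersion x) :
    IsFiniteMeasure (area x) := by
  suffices h : IsLocallyFiniteMeasure (area x) from inferInstance
  refine ⟨fun p => ?_⟩
  set φ := extChartAt (𝓡∂ n) p with hφ
  set C := chartDensity x p (φ p) + 1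
  have hd : ContinuousOn (fun q => chartDensity x p (φ q)) φ.source :=
    (continuousOn_chartDensity hx p).comp (continuousOn_extChartAt p) φ.mapsTo
  have h1 : ∀ᶠ q in 𝓝 p, chartDensity x p (φ q) < C :=
    (hd.continuousAt (extChartAt_source_mem_nhds p)).eventually_lt_const (lt_add_one _)
  have h2 : ∀ᶠ q in 𝓝 p, φ q ∈ Metric.ball (φ p) 1 :=
    (continuousAt_extChartAt p).eventually_mem (Metric.ball_mem_nhds _ one_pos)
  obtain ⟨O, hO, hOo, hpO⟩ := mem_nhds_iff.1
    ((h1.and h2).and (extChartAt_source_mem_nhds (I := 𝓡∂ n) p))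
  refine ⟨O, hOo.mem_nhds hpO, ?_⟩
  have hOU : O ∩ φ.source = O := inter_eq_left.2 fun q hq => (hO hq).2
  rw [← hOU, ← Measure.restrict_apply hOo.measurableSet, area_restrict_source hx p,
    chartArea_apply p hOo.measurableSet]
  have hbound : ∀ y ∈ φ.symm ⁻¹' O ∩ φ.target,
      ENNReal.ofReal (chartDensity x p y) ≤ ENNReal.ofReal C := by
    rintro y ⟨hy, hyt⟩
    have h := (hO hy).1.1
    rw [φ.right_inv hyt] at h
    exact ENNReal.ofReal_le_ofReal h.le
  refine (setLIntegral_mono measurable_const hbound).trans_lt ?_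
  rw [setLIntegral_const]
  refine ENNReal.mul_lt_top ENNReal.ofReal_lt_top ?_
  refine (measure_mono ?_).trans_lt (measure_ball_lt_top (x := φ p) (r := 1))
  rintro y ⟨hy, hyt⟩
  have h := (hO hy).1.2
  rwa [φ.right_inv hyt] at h

end Area

/-! ### Tangent vectors in coordinates and transversality to the sphere. -/

section Tangential

variable {n : ℕ} {F : Type*} [NormedAddCommGroup F] [InnerProductSpace ℝ F]

/-- The coefficients of the projection of `w` to the range of `D` in the frame `D e_j`. -/
def metricCoeff (D : EuclideanSpace ℝ (Fin n) →L[ℝ] F) (w : F) (j : Fin n) : ℝ :=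
  ∑ k, (pairing D D)⁻¹ j k * ⟪w, D (EuclideanSpace.single k 1)⟫

lemma metricCoeff_map {D : EuclideanSpace ℝ (Fin n) →L[ℝ] F} (hD : Function.Injective D)
    (v : EuclideanSpace ℝ (Fin n)) (j : Fin n) : metricCoeff D (D v) j = v j := by
  have h1 : ∀ k, ⟪D v, D (EuclideanSpace.single k 1)⟫ = (pairing D D *ᵥ v) k := fun k => by
    rw [map_eq_sum_single, sum_inner, Matrix.mulVec, dotProduct]
    refine Finset.sum_congr rfl fun i _ => ?_
    rw [inner_smul_left, pairing_apply, real_inner_comm, conj_trivial, mul_comm]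
  have h2 : metricCoeff D (D v) j = ((pairing D D)⁻¹ *ᵥ (pairing D D *ᵥ v)) j := by
    simp only [metricCoeff, h1]
    rfl
  rw [h2, Matrix.mulVec_mulVec,
    Matrix.nonsing_inv_mul _ (isUnit_iff_ne_zero.2 (det_pairing_self_pos hD).ne'), Matrix.one_mulVec]

lemma metricCoeff_zero (D : EuclideanSpace ℝ (Fin n) →L[ℝ] F) (j : Fin n) :
    metricCoeff D 0 j = 0 := by
  simp [metricCoeff]

/-- The range of `D` lies in the orthogonal complement of `N`, and both have dimension `n`. -/
lemma exists_eq_map_of_inner_eq_zero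
    {D : EuclideanSpace ℝ (Fin n) →L[ℝ] EuclideanSpace ℝ (Fin (n + 1))}
    (hD : Function.Injective D) {N w : EuclideanSpace ℝ (Fin (n + 1))} (hN : ‖N‖ = 1)
    (hND : ∀ v, ⟪N, D v⟫ = 0) (hw : ⟪w, N⟫ = 0) : ∃ v, w = D v := by
  have hN0 : N ≠ 0 := fun h => by simp [h] at hN
  have : Fact (Module.finrank ℝ (EuclideanSpace ℝ (Fin (n + 1))) = n + 1) := ⟨by simp⟩
  have hle : LinearMap.range (D : EuclideanSpace ℝ (Fin n) →ₗ[ℝ] _) ≤ (ℝ ∙ N)ᗮ := by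
    rintro _ ⟨v, rfl⟩
    exact Submodule.mem_orthogonal_singleton_iff_inner_right.2 (hND v)
  have heq := Submodule.eq_of_le_of_finrank_eq hle (by
    rw [LinearMap.finrank_range_of_inj hD, Submodule.finrank_orthogonal_span_singleton (n := n) hN0]
    simp)
  have hmem : w ∈ (ℝ ∙ N)ᗮ := Submodule.mem_orthogonal_singleton_iff_inner_left.2 hw
  rw [← heq] at hmem
  obtain ⟨v, hv⟩ := hmem
  exact ⟨v, hv.symm⟩

/-- Pairing with `ξ` sees only the coordinate `0`, so either `v 0 = 0` or `ξ` is orthogonal to the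
whole range of `D`. In the second case the tangential part `ξ - ⟨N, ξ⟩ N` is orthogonal to `ξ`,
forcing `⟨N, ξ⟩ ^ 2 = 1`. Here `ξ` plays the position vector on the sphere. -/
lemma apply_zero_eq_zero_of_inner_eq_zero [NeZero n]
    {D : EuclideanSpace ℝ (Fin n) →L[ℝ] EuclideanSpace ℝ (Fin (n + 1))}
    (hD : Function.Injective D) {N ξ : EuclideanSpace ℝ (Fin (n + 1))} (hN : ‖N‖ = 1)
    (hND : ∀ v, ⟪N, D v⟫ = 0) (hξ : ‖ξ‖ = 1) (hNξ : ⟪N, ξ⟫ ^ 2 ≠ 1)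
    (hξD : ∀ k : Fin n, k ≠ 0 → ⟪ξ, D (EuclideanSpace.single k 1)⟫ = 0)
    {v : EuclideanSpace ℝ (Fin n)} (hv : ⟪D v, ξ⟫ = 0) : v 0 = 0 := by
  have h : ∀ u : EuclideanSpace ℝ (Fin n),
      ⟪D u, ξ⟫ = u 0 * ⟪D (EuclideanSpace.single 0 1), ξ⟫ := fun u => by
    rw [map_eq_sum_single, sum_inner, Finset.sum_eq_single 0 (fun k _ hk => by
      rw [inner_smul_left, real_inner_comm, hξD k hk, mul_zero]) (by simp), inner_smul_left]
    rfl
  rw [h] at hv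
  refine (mul_eq_zero.1 hv).resolve_right fun h0 => hNξ ?_
  obtain ⟨u, hu⟩ := exists_eq_map_of_inner_eq_zero hD (w := ξ - ⟪N, ξ⟫ • N) hN hND (by
    rw [inner_sub_left, inner_smul_left, real_inner_self_eq_norm_sq, hN, real_inner_comm]
    simp)
  have h1 := h u
  rw [h0, mul_zero, ← hu, inner_sub_left, inner_smul_left, real_inner_self_eq_norm_sq, hξ] at h1
  simp only [conj_trivial] at h1
  nlinarith [h1]

end Tangential

/-! ### The divergence theorem for fields supported in one chart. -/

section LocalDivergence

variable {n : ℕ} [NeZero n] {M : Type*} [TopologicalSpace M] [ChartedSpace (EuclideanHalfSpace n) M]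

lemma volume_boundary_halfSpace :
    volume {y : EuclideanSpace ℝ (Fin n) | y 0 = 0} = 0 := by
  have h := Measure.addHaar_submodule (volume : Measure (EuclideanSpace ℝ (Fin n)))
    (LinearMap.ker (EuclideanSpace.proj (𝕜 := ℝ) (0 : Fin n)).toLinearMap) (fun h => by
      have h1 : EuclideanSpace.single (0 : Fin n) (1 : ℝ) ∈ (⊤ : Submodule ℝ _) := trivial
      rw [← h] at h1
      simp at h1)
  exact h

/-- The components of `√det g • W` in the preferred chart at `p`, extended by zero. -/
def chartFlux (x W : M → EuclideanSpace ℝ (Fin (n + 1))) (p : M) (j : Fin n) :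
    EuclideanSpace ℝ (Fin n) → ℝ :=
  (extChartAt (𝓡∂ n) p).target.indicator fun y =>
    chartDensity x p y * metricCoeff (coordDiff x p y) (W ((extChartAt (𝓡∂ n) p).symm y)) j

variable {x ν W : M → EuclideanSpace ℝ (Fin (n + 1))}

lemma chartFlux_eq_zero {p : M} {j : Fin n} {y : EuclideanSpace ℝ (Fin n)}
    (hy : y ∉ extChartAt (𝓡∂ n) p '' tsupport W) : chartFlux x W p j y = 0 := by
  by_cases hyt : y ∈ (extChartAt (𝓡∂ n) p).target
  · have h : W ((extChartAt (𝓡∂ n) p).symm y) = 0 := by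
      by_contra h
      exact hy ⟨_, subset_tsupport W h, (extChartAt (𝓡∂ n) p).right_inv hyt⟩
    rw [chartFlux, indicator_of_mem hyt, h, metricCoeff_zero, mul_zero]
  · exact indicator_of_notMem hyt _

lemma isCompact_image_tsupport [CompactSpace M] {p : M}
    (hWp : tsupport W ⊆ (extChartAt (𝓡∂ n) p).source) :
    IsCompact (extChartAt (𝓡∂ n) p '' tsupport W) :=
  (isClosed_tsupport W).isCompact.image_of_continuousOn ((continuousOn_extChartAt p).mono hWp)

/-- The support has compact image inside the chart target, so the extension by zero is smooth up to
and across the edge of the target. -/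
lemma chartFlux_eventuallyEq_zero [CompactSpace M] {p : M}
    (hWp : tsupport W ⊆ (extChartAt (𝓡∂ n) p).source) (j : Fin n) {y : EuclideanSpace ℝ (Fin n)}
    (hy : y ∉ (extChartAt (𝓡∂ n) p).target) : chartFlux x W p j =ᶠ[𝓝 y] fun _ => 0 := by
  have hyK : y ∉ extChartAt (𝓡∂ n) p '' tsupport W := by
    rintro ⟨q, hq, rfl⟩
    exact hy ((extChartAt (𝓡∂ n) p).map_source (hWp hq))
  filter_upwards [(isCompact_image_tsupport hWp).isClosed.isOpen_compl.mem_nhds hyK] with z hz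
  exact chartFlux_eq_zero hz

variable [IsManifold (𝓡∂ n) ∞ M]

lemma mem_boundary_of_apply_zero_eq_zero {p : M} {y : EuclideanSpace ℝ (Fin n)}
    (hy : y ∈ (extChartAt (𝓡∂ n) p).target) (hy0 : y 0 = 0) :
    (extChartAt (𝓡∂ n) p).symm y ∈ (𝓡∂ n).boundary M := by
  have : IsManifold (𝓡∂ n) 1 M := IsManifold.of_le (n := ∞) (by simp)
  have hq := (extChartAt (𝓡∂ n) p).map_target hy
  rw [extChartAt_source] at hq
  refine ((𝓡∂ n).isBoundaryPoint_iff_of_mem_atlas one_ne_zero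
    (chart_mem_atlas (EuclideanHalfSpace n) p) hq).2 ?_
  change extChartAt (𝓡∂ n) p _ ∈ frontier (extChartAt (𝓡∂ n) p).target
  rw [(extChartAt (𝓡∂ n) p).right_inv hy]
  refine ⟨subset_closure hy, fun hi => ?_⟩
  have h1 := interior_mono (extChartAt_target_subset_range p) hi
  rw [range_eq_halfSpace, interior_halfSpace] at h1
  exact (lt_irrefl _ (hy0 ▸ h1 : (0 : ℝ) < 0))

lemma inner_normal_coordDiff (hx : IsSmoothImmersion x) (hν : IsUnitNormal x ν) {p q : M}
    (hq : q ∈ (extChartAt (𝓡∂ n) p).source) (v : EuclideanSpace ℝ (Fin n)) :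
    ⟪ν q, coordDiff x p (extChartAt (𝓡∂ n) p q) v⟫ = 0 := by
  rw [coordDiff_change hx.smooth hq (mem_extChartAt_source q), ← diff_eq_coordDiff hx.smooth]
  exact hν.inner_eq_zero q _

lemma exists_eq_coordDiff (hx : IsSmoothImmersion x) (hν : IsUnitNormal x ν)
    (hWν : ∀ q, ⟪W q, ν q⟫ = 0) {p : M} {y : EuclideanSpace ℝ (Fin n)}
    (hy : y ∈ (extChartAt (𝓡∂ n) p).target) :
    ∃ v, W ((extChartAt (𝓡∂ n) p).symm y) = coordDiff x p y v := by
  have hq := (extChartAt (𝓡∂ n) p).map_target hy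
  have hinj := coordDiff_injective hx hq
  have hN := inner_normal_coordDiff hx hν hq
  rw [(extChartAt (𝓡∂ n) p).right_inv hy] at hinj hN
  exact exists_eq_map_of_inner_eq_zero hinj (hν.norm_eq_one _) hN (hWν _)

lemma coordDiff_injective_of_mem_target (hx : IsSmoothImmersion x) {p : M}
    {y : EuclideanSpace ℝ (Fin n)} (hy : y ∈ (extChartAt (𝓡∂ n) p).target) :
    Function.Injective (coordDiff x p y) := by
  have h := coordDiff_injective hx ((extChartAt (𝓡∂ n) p).map_target hy)
  rwa [(extChartAt (𝓡∂ n) p).right_inv hy] at h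

lemma contDiffWithinAt_metricCoeff (hx : IsSmoothImmersion x)
    (hW : ContMDiff (𝓡∂ n) 𝓘(ℝ, EuclideanSpace ℝ (Fin (n + 1))) ∞ W) {p : M} (j : Fin n)
    {y : EuclideanSpace ℝ (Fin n)} (hy : y ∈ (extChartAt (𝓡∂ n) p).target) :
    ContDiffWithinAt ℝ ∞ (fun z => metricCoeff (coordDiff x p z)
      (W ((extChartAt (𝓡∂ n) p).symm z)) j) (range (𝓡∂ n)) y := by
  have hD := contDiffWithinAt_coordDiff hx.smooth hy
  exact ContDiffWithinAt.sum fun k _ => (contDiffWithinAt_matrix_inv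
    (contDiffWithinAt_pairing hD hD)
    (det_pairing_self_pos (coordDiff_injective_of_mem_target hx hy)).ne' _ _).mul
      ((contDiffWithinAt_comp_extChartAt_symm hW hy).inner ℝ (hD.clm_apply contDiffWithinAt_const))

lemma contDiffOn_chartFlux [CompactSpace M] (hx : IsSmoothImmersion x)
    (hW : ContMDiff (𝓡∂ n) 𝓘(ℝ, EuclideanSpace ℝ (Fin (n + 1))) ∞ W) {p : M}
    (hWp : tsupport W ⊆ (extChartAt (𝓡∂ n) p).source) (j : Fin n) :
    ContDiffOn ℝ 1 (chartFlux x W p j) (range (𝓡∂ n)) := by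
  intro y hy
  by_cases hyt : y ∈ (extChartAt (𝓡∂ n) p).target
  · have h := (contDiffWithinAt_sqrt_det_pairing (contDiffWithinAt_coordDiff hx.smooth hyt)
      (coordDiff_injective_of_mem_target hx hyt)).mul (contDiffWithinAt_metricCoeff hx hW j hyt)
    refine (h.congr_of_eventuallyEq_of_mem ?_ hy).of_le (by simp)
    filter_upwards [extChartAt_target_mem_nhdsWithin_of_mem hyt] with z hz
    rw [chartFlux, indicator_of_mem hz, chartDensity_eq]
  · exact (contDiffAt_const.congr_of_eventuallyEq
      (chartFlux_eventuallyEq_zero hWp j hyt)).contDiffWithinAt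

/-- Off the face `y 0 = 0` derivatives within the half-space are ordinary ones, so the coordinate
formula for the divergence applies. -/
lemma sum_fderivWithin_chartFlux [CompactSpace M] (hx : IsSmoothImmersion x)
    (hν : IsUnitNormal x ν)
    (hW : ContMDiff (𝓡∂ n) 𝓘(ℝ, EuclideanSpace ℝ (Fin (n + 1))) ∞ W)
    (hWν : ∀ q, ⟪W q, ν q⟫ = 0) {p : M} {y : EuclideanSpace ℝ (Fin n)}
    (hy : y ∈ (extChartAt (𝓡∂ n) p).target) (hy0 : y 0 ≠ 0) :
    ∑ j, fderivWithin ℝ (chartFlux x W p j) {y | 0 ≤ y 0} y (EuclideanSpace.single j 1) =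
      chartDensity x p y * divergence x W ((extChartAt (𝓡∂ n) p).symm y) := by
  set φ := extChartAt (𝓡∂ n) p with hφ
  have hint : ∀ᶠ z in 𝓝 y, range (𝓡∂ n) ∈ 𝓝 z := by
    have h0 : y ∈ interior (range (𝓡∂ n)) := by
      have := extChartAt_target_subset_range p hy
      rw [range_eq_halfSpace] at this ⊢
      rw [interior_halfSpace]
      exact lt_of_le_of_ne this hy0.symm
    filter_upwards [isOpen_interior.mem_nhds h0] with z hz
    exact mem_interior_iff_mem_nhds.1 hz
  have hyr : range (𝓡∂ n) ∈ 𝓝 y := hint.self_of_nhds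
  have htgt : φ.target ∈ 𝓝 y := by
    have := extChartAt_target_mem_nhdsWithin_of_mem hy
    rwa [nhdsWithin_eq_nhds.2 hyr] at this
  have hcd : ∀ f : M → EuclideanSpace ℝ (Fin (n + 1)), ∀ᶠ z in 𝓝 y,
      coordDiff f p z = fderiv ℝ (f ∘ φ.symm) z := fun f => by
    filter_upwards [hint] with z hz
    exact fderivWithin_of_mem_nhds hz
  have hflux : ∀ j, fderivWithin ℝ (chartFlux x W p j) {y | 0 ≤ y 0} y =
      fderiv ℝ (fun z => √(pairing (fderiv ℝ (x ∘ φ.symm) z) (fderiv ℝ (x ∘ φ.symm) z)).det *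
        metricCoeff (coordDiff x p z) (W (φ.symm z)) j) y := fun j => by
    rw [← range_eq_halfSpace, fderivWithin_of_mem_nhds hyr]
    refine Filter.EventuallyEq.fderiv_eq ?_
    filter_upwards [htgt, hcd x] with z hz hz'
    rw [chartFlux, indicator_of_mem hz, chartDensity_eq, hz']
  simp only [hflux]
  have hX : ContDiffAt ℝ 2 (x ∘ φ.symm) y :=
    ((contDiffWithinAt_comp_extChartAt_symm hx.smooth hy).contDiffAt hyr).of_le
      (WithTop.coe_le_coe.2 le_top : ((2 : ℕ∞) : WithTop ℕ∞) ≤ ∞)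
  have hinj := coordDiff_injective_of_mem_target hx hy
  rw [(hcd x).self_of_nhds] at hinj
  have hVW : (W ∘ φ.symm) =ᶠ[𝓝 y] fun z => ∑ k, metricCoeff (coordDiff x p z) (W (φ.symm z)) k •
      fderiv ℝ (x ∘ φ.symm) z (EuclideanSpace.single k 1) := by
    filter_upwards [htgt, hcd x] with z hz hz'
    obtain ⟨v, hv⟩ := exists_eq_coordDiff hx hν hWν hz
    rw [Function.comp_apply, hv, ← hz']
    simp only [metricCoeff_map (coordDiff_injective_of_mem_target hx hz)]
    exact map_eq_sum_single _ _
  rw [sum_fderiv_sqrt_det_mul hX hinj (fun j => ((contDiffWithinAt_metricCoeff hx hW j hy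
    ).contDiffAt hyr).differentiableAt (by simp)) hVW,
    divergence_eq_metricTrace_coordDiff hx hW (φ.map_target hy), ← hφ, φ.right_inv hy,
    chartDensity_eq, (hcd x).self_of_nhds, (hcd W).self_of_nhds]

/-- For `k ≠ 0` the line `y + t e_k` stays on the face, hence on the boundary of `M` for small `t`,
where `‖x‖ ^ 2` is constant. -/
lemma inner_coordDiff_single_eq_zero (hx : IsSmoothImmersion x)
    (hsphere : ∀ q ∈ (𝓡∂ n).boundary M, ‖x q‖ = 1) {p : M} {y : EuclideanSpace ℝ (Fin n)}
    (hy : y ∈ (extChartAt (𝓡∂ n) p).target) (hy0 : y 0 = 0) {k : Fin n} (hk : k ≠ 0) :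
    ⟪x ((extChartAt (𝓡∂ n) p).symm y), coordDiff x p y (EuclideanSpace.single k 1)⟫ = 0 := by
  set φ := extChartAt (𝓡∂ n) p with hφ
  set c : ℝ → EuclideanSpace ℝ (Fin n) := fun t => y + t • EuclideanSpace.single k 1 with hc
  have hc0 : c 0 = y := by simp [hc]
  have hcz : ∀ t, c t 0 = 0 := fun t => by simp [hc, hy0, hk.symm]
  have hcr : ∀ t, c t ∈ range (𝓡∂ n) := fun t => by
    rw [range_eq_halfSpace]; exact (hcz t).ge
  have hcd : HasDerivAt c (EuclideanSpace.single k 1) 0 := by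
    simpa [hc] using ((hasDerivAt_id (0 : ℝ)).smul_const
      (EuclideanSpace.single k (1 : ℝ) : EuclideanSpace ℝ (Fin n))).const_add y
  have hD : HasFDerivWithinAt (x ∘ φ.symm) (coordDiff x p y) (range (𝓡∂ n)) (c 0) := by
    rw [hc0]
    exact ((contDiffWithinAt_comp_extChartAt_symm hx.smooth hy).differentiableWithinAt
      (by simp)).hasFDerivWithinAt
  have hX : HasDerivAt ((x ∘ φ.symm) ∘ c) (coordDiff x p y (EuclideanSpace.single k 1)) 0 :=
    hasDerivWithinAt_univ.1 (hD.comp_hasDerivWithinAt 0 hcd.hasDerivWithinAt fun t _ => hcr t)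
  have hsq := hX.norm_sq
  have hone : (fun t => ‖((x ∘ φ.symm) ∘ c) t‖ ^ 2) =ᶠ[𝓝 0] fun _ => 1 := by
    have ht : Tendsto c (𝓝 0) (𝓝[range (𝓡∂ n)] y) := by
      refine tendsto_nhdsWithin_iff.2 ⟨?_, Eventually.of_forall hcr⟩
      have := hcd.continuousAt.tendsto
      rwa [hc0] at this
    filter_upwards [ht (extChartAt_target_mem_nhdsWithin_of_mem hy)] with t ht'
    rw [Function.comp_apply, Function.comp_apply,
      hsphere _ (mem_boundary_of_apply_zero_eq_zero ht' (hcz t)), one_pow]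
  have h0 := (hsq.congr_of_eventuallyEq hone.symm).unique (hasDerivAt_const 0 (1 : ℝ))
  rw [Function.comp_apply, Function.comp_apply, hc0] at h0
  linarith

lemma chartFlux_zero_eq_zero (hx : IsSmoothImmersion x) (hν : IsUnitNormal x ν)
    (hWν : ∀ q, ⟪W q, ν q⟫ = 0) (hsphere : ∀ q ∈ (𝓡∂ n).boundary M, ‖x q‖ = 1)
    (hne : ∀ q ∈ (𝓡∂ n).boundary M, ⟪ν q, x q⟫ ^ 2 ≠ 1)
    (hWx : ∀ q ∈ (𝓡∂ n).boundary M, ⟪W q, x q⟫ = 0) (p : M) {y : EuclideanSpace ℝ (Fin n)}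
    (hy0 : y 0 = 0) : chartFlux x W p 0 y = 0 := by
  by_cases hy : y ∈ (extChartAt (𝓡∂ n) p).target
  · have hb := mem_boundary_of_apply_zero_eq_zero hy hy0
    have hinj := coordDiff_injective_of_mem_target hx hy
    obtain ⟨v, hv⟩ := exists_eq_coordDiff hx hν hWν hy
    have hN := inner_normal_coordDiff hx hν ((extChartAt (𝓡∂ n) p).map_target hy)
    rw [(extChartAt (𝓡∂ n) p).right_inv hy] at hN
    have hv0 := apply_zero_eq_zero_of_inner_eq_zero hinj (hν.norm_eq_one _) hN (hsphere _ hb)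
      (hne _ hb) (fun k hk => inner_coordDiff_single_eq_zero hx hsphere hy hy0 hk)
      (hv ▸ hWx _ hb)
    rw [chartFlux, indicator_of_mem hy, hv, metricCoeff_map hinj, hv0, mul_zero]
  · exact indicator_of_notMem hy _

variable [MeasurableSpace M] [BorelSpace M]

lemma integral_divergence_eq_zero_of_tsupport_subset [CompactSpace M] (hx : IsSmoothImmersion x)
    (hν : IsUnitNormal x ν) (hW : ContMDiff (𝓡∂ n) 𝓘(ℝ, EuclideanSpace ℝ (Fin (n + 1))) ∞ W)
    (hWν : ∀ q, ⟪W q, ν q⟫ = 0) (hsphere : ∀ q ∈ (𝓡∂ n).boundary M, ‖x q‖ = 1)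
    (hne : ∀ q ∈ (𝓡∂ n).boundary M, ⟪ν q, x q⟫ ^ 2 ≠ 1)
    (hWx : ∀ q ∈ (𝓡∂ n).boundary M, ⟪W q, x q⟫ = 0) {p : M}
    (hWp : tsupport W ⊆ (extChartAt (𝓡∂ n) p).source) :
    ∫ q, divergence x W q ∂(area x) = 0 := by
  have hsupp : ∀ q ∉ (extChartAt (𝓡∂ n) p).source, divergence x W q = 0 := fun q hq => by
    have h : W =ᶠ[𝓝 q] fun _ => 0 := by
      filter_upwards [(isClosed_tsupport W).isOpen_compl.mem_nhds fun h => hq (hWp h)] with z hz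
      exact image_eq_zero_of_notMem_tsupport hz
    have h2 : diff W q = 0 := h.mfderiv_eq.trans mfderiv_const
    rw [divergence, h2, metricTrace_zero]
  rw [integral_area_eq_setIntegral hx p (continuous_divergence hx hW) hsupp,
    ← setIntegral_halfSpace_divergence_eq_zero (isCompact_image_tsupport hWp)
      (f := chartFlux x W p)
      (fun j => by simpa only [range_eq_halfSpace] using contDiffOn_chartFlux hx hW hWp j)
      (fun j y _ hy => chartFlux_eq_zero hy)
      (fun y hy => chartFlux_zero_eq_zero hx hν hWν hsphere hne hWx p hy)]
  have hsub : (extChartAt (𝓡∂ n) p).target ⊆ {y : EuclideanSpace ℝ (Fin n) | 0 ≤ y 0} := by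
    rw [← range_eq_halfSpace]
    exact extChartAt_target_subset_range p
  rw [setIntegral_eq_of_subset_of_forall_sdiff_eq_zero (isClosed_halfSpace n).measurableSet hsub]
  · refine setIntegral_congr_ae (measurableSet_extChartAt_target p) ?_
    -- The face `y 0 = 0` is a null set, so the pointwise formula is needed only off it.
    filter_upwards [measure_eq_zero_iff_ae_notMem.1 (volume_boundary_halfSpace (n := n))]
      with y hy0 hy
    exact (sum_fderivWithin_chartFlux hx hν hW hWν hy hy0).symm
  · rintro y ⟨_, hy⟩
    refine Finset.sum_eq_zero fun j _ => ?_
    have h := chartFlux_eventuallyEq_zero (x := x) hWp j hy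
    rw [(h.filter_mono nhdsWithin_le_nhds).fderivWithin_eq h.self_of_nhds,
      fderivWithin_const_apply]
    rfl

end LocalDivergence

/-! ### The global divergence theorem and the symmetry of the shape operator. -/

section Global

variable {n : ℕ} [NeZero n] {M : Type*} [TopologicalSpace M] [ChartedSpace (EuclideanHalfSpace n) M]

lemma uniqueDiffWithinAt_range_extChartAt (q : M) :
    UniqueDiffWithinAt ℝ (range (𝓡∂ n)) (extChartAt (𝓡∂ n) q q) :=
  (𝓡∂ n).uniqueDiffOn _ (extChartAt_target_subset_range q (mem_extChartAt_target q))

variable [IsManifold (𝓡∂ n) ∞ M] {f x ν W : M → EuclideanSpace ℝ (Fin (n + 1))}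

lemma hasFDerivWithinAt_diff (hf : ContMDiff (𝓡∂ n) 𝓘(ℝ, EuclideanSpace ℝ (Fin (n + 1))) ∞ f)
    (q : M) : HasFDerivWithinAt (f ∘ (extChartAt (𝓡∂ n) q).symm) (diff f q) (range (𝓡∂ n))
      (extChartAt (𝓡∂ n) q q) := by
  rw [diff_eq_coordDiff hf]
  exact ((contDiffWithinAt_comp_extChartAt_symm hf (mem_extChartAt_target q)).differentiableWithinAt
    (by simp)).hasFDerivWithinAt

lemma diff_finset_sum {ι : Type*} (s : Finset ι) {V : ι → M → EuclideanSpace ℝ (Fin (n + 1))}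
    (hV : ∀ i, ContMDiff (𝓡∂ n) 𝓘(ℝ, EuclideanSpace ℝ (Fin (n + 1))) ∞ (V i))
    (hf : ContMDiff (𝓡∂ n) 𝓘(ℝ, EuclideanSpace ℝ (Fin (n + 1))) ∞ f)
    (hfV : ∀ q, f q = ∑ i ∈ s, V i q) (q : M) : diff f q = ∑ i ∈ s, diff (V i) q := by
  have h := HasFDerivWithinAt.fun_sum (u := s) fun i _ => hasFDerivWithinAt_diff (hV i) q
  refine (uniqueDiffWithinAt_range_extChartAt q).eq (hasFDerivWithinAt_diff hf q)
    (h.congr (fun y _ => hfV _) (hfV _))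

/-- The divergence theorem for a vector field on the hypersurface tangent to the boundary. -/
lemma integral_divergence_eq_zero [T2Space M] [CompactSpace M] [MeasurableSpace M] [BorelSpace M]
    (hx : IsSmoothImmersion x) (hν : IsUnitNormal x ν)
    (hW : ContMDiff (𝓡∂ n) 𝓘(ℝ, EuclideanSpace ℝ (Fin (n + 1))) ∞ W)
    (hWν : ∀ q, ⟪W q, ν q⟫ = 0) (hsphere : ∀ q ∈ (𝓡∂ n).boundary M, ‖x q‖ = 1)
    (hne : ∀ q ∈ (𝓡∂ n).boundary M, ⟪ν q, x q⟫ ^ 2 ≠ 1)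
    (hWx : ∀ q ∈ (𝓡∂ n).boundary M, ⟪W q, x q⟫ = 0) :
    ∫ q, divergence x W q ∂(area x) = 0 := by
  obtain ⟨t, ht⟩ := isCompact_univ.elim_finite_subcover
    (fun p : M => (extChartAt (𝓡∂ n) p).source) (fun p => isOpen_extChartAt_source p)
    (fun q _ => mem_iUnion.2 ⟨q, mem_extChartAt_source q⟩)
  obtain ⟨ρ, hρ⟩ := SmoothPartitionOfUnity.exists_isSubordinate (𝓡∂ n) isClosed_univ
    (fun p : t => (extChartAt (𝓡∂ n) (p : M)).source) (fun p => isOpen_extChartAt_source _)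
    (by simpa only [iUnion_subtype] using ht)
  have hV : ∀ p : t, ContMDiff (𝓡∂ n) 𝓘(ℝ, EuclideanSpace ℝ (Fin (n + 1))) ∞
      fun q => ρ p q • W q := fun p => (ρ p).contMDiff.smul hW
  have hsum : ∀ q, W q = ∑ p : t, ρ p q • W q := fun q => by
    rw [← Finset.sum_smul, ← finsum_eq_sum_of_fintype, ρ.sum_eq_one (mem_univ q), one_smul]
  have hdiv : ∀ q, divergence x W q = ∑ p : t, divergence x (fun q => ρ p q • W q) q := fun q => by
    simp only [divergence]
    rw [diff_finset_sum Finset.univ hV hW hsum, metricTrace_sum]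
  have := isFiniteMeasure_area hx
  simp only [hdiv]
  rw [integral_finsetSum _ fun p _ => (continuous_divergence hx (hV p)
    ).integrable_of_hasCompactSupport (HasCompactSupport.of_compactSpace _)]
  refine Finset.sum_eq_zero fun p _ => ?_
  refine integral_divergence_eq_zero_of_tsupport_subset hx hν (hV p) (fun q => ?_) hsphere hne
    (fun q hq => ?_) (p := p) ?_
  · rw [inner_smul_left, hWν, mul_zero]
  · rw [inner_smul_left, hWx q hq, mul_zero]
  · exact (tsupport_smul_subset_left _ _).trans (hρ p)

/-- Differentiating `⟨ν, ν⟩ = 1`. With `exists_eq_map_of_inner_eq_zero` it shows that `dν` takes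
values in the tangent space. -/
lemma inner_diff_normal_self (hν : IsUnitNormal x ν) (q : M) (u : EuclideanSpace ℝ (Fin n)) :
    ⟪diff ν q u, ν q⟫ = 0 := by
  have h := (hasFDerivWithinAt_diff hν.smooth q).inner ℝ (hasFDerivWithinAt_diff hν.smooth q)
  have h1 : HasFDerivWithinAt (fun _ : EuclideanSpace ℝ (Fin n) => (1 : ℝ)) 0 (range (𝓡∂ n))
      (extChartAt (𝓡∂ n) q q) := hasFDerivWithinAt_const (𝕜 := ℝ) _ _ _
  have hone : ∀ y, ⟪(ν ∘ (extChartAt (𝓡∂ n) q).symm) y, (ν ∘ (extChartAt (𝓡∂ n) q).symm) y⟫ =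
      (1 : ℝ) := fun y => by
    rw [Function.comp_apply, real_inner_self_eq_norm_sq, hν.norm_eq_one, one_pow]
  have h2 := (uniqueDiffWithinAt_range_extChartAt q).eq h
    (h1.congr (fun y _ => hone y) (hone _))
  have h3 := DFunLike.congr_fun h2 u
  simp only [ContinuousLinearMap.comp_apply, fderivInnerCLM_apply, ContinuousLinearMap.prod_apply,
    Function.comp_apply, extChartAt_to_inv, _root_.zero_apply] at h3
  rw [real_inner_comm] at h3
  linarith

/-- Differentiating `⟨ν, dx v⟩ = 0` along `u` gives `⟨dν u, dx v⟩ = -⟨ν, D²x(u, v)⟩`, and the second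
derivative is symmetric. -/
lemma inner_diff_normal_symm (hx : IsSmoothImmersion x) (hν : IsUnitNormal x ν) (q : M)
    (u v : EuclideanSpace ℝ (Fin n)) :
    ⟪diff ν q u, diff x q v⟫ = ⟪diff ν q v, diff x q u⟫ := by
  set φ := extChartAt (𝓡∂ n) q with hφ
  have hmem : φ q ∈ range (𝓡∂ n) := extChartAt_target_subset_range q (mem_extChartAt_target q)
  have hX := contDiffWithinAt_comp_extChartAt_symm hx.smooth (mem_extChartAt_target (I := 𝓡∂ n) q)
  -- Symmetry also holds at boundary points, since the half-space lies in the closure of its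
  -- interior.
  have hsymm : IsSymmSndFDerivWithinAt ℝ (x ∘ φ.symm) (range (𝓡∂ n)) (φ q) :=
    hX.isSymmSndFDerivWithinAt (by
      simpa using (WithTop.coe_le_coe.2 le_top : ((2 : ℕ∞) : WithTop ℕ∞) ≤ ∞))
      (𝓡∂ n).uniqueDiffOn ((𝓡∂ n).range_subset_closure_interior hmem) hmem
  have hD : HasFDerivWithinAt (coordDiff x q)
      (fderivWithin ℝ (coordDiff x q) (range (𝓡∂ n)) (φ q)) (range (𝓡∂ n)) (φ q) :=
    ((contDiffWithinAt_coordDiff hx.smooth (mem_extChartAt_target q)).differentiableWithinAt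
      (by simp)).hasFDerivWithinAt
  have key : ∀ u v, ⟪ν q, fderivWithin ℝ (coordDiff x q) (range (𝓡∂ n)) (φ q) u v⟫ +
      ⟪diff ν q u, diff x q v⟫ = 0 := fun u v => by
    have h := (hasFDerivWithinAt_diff hν.smooth q).inner ℝ
      (hD.clm_apply (hasFDerivWithinAt_const v _ _))
    have h1 : HasFDerivWithinAt (fun _ : EuclideanSpace ℝ (Fin n) => (0 : ℝ)) 0 (range (𝓡∂ n))
      (φ q) := hasFDerivWithinAt_const (𝕜 := ℝ) _ _ _
    have hev : (fun y => ⟪(ν ∘ φ.symm) y, coordDiff x q y v⟫) =ᶠ[𝓝[range (𝓡∂ n)] (φ q)]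
        fun _ => 0 := by
      filter_upwards [extChartAt_target_mem_nhdsWithin (I := 𝓡∂ n) q] with y hy
      have h2 := inner_normal_coordDiff hx hν (φ.map_target hy) v
      rwa [← hφ, φ.right_inv hy] at h2
    have h2 := (uniqueDiffWithinAt_range_extChartAt q).eq h
      (h1.congr_of_eventuallyEq hev (hev.self_of_nhdsWithin hmem))
    have h3 := DFunLike.congr_fun h2 u
    simpa only [ContinuousLinearMap.comp_apply, fderivInnerCLM_apply,
      ContinuousLinearMap.prod_apply, Function.comp_apply, hφ, extChartAt_to_inv,
      ← diff_eq_coordDiff hx.smooth, _root_.zero_apply, _root_.add_apply,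
      ContinuousLinearMap.flip_apply, map_zero, zero_add] using h3
  have h1 := key u v
  have h2 := key v u
  have h3 : fderivWithin ℝ (coordDiff x q) (range (𝓡∂ n)) (φ q) u v =
      fderivWithin ℝ (coordDiff x q) (range (𝓡∂ n)) (φ q) v u := hsymm u v
  rw [h3] at h1
  linarith

end Global

/-! ### The trace identity behind the divergence of the capillary field. -/

section CapillaryField

variable {n : ℕ} {F : Type*} [NormedAddCommGroup F] [InnerProductSpace ℝ F]

lemma trace_mul_eq_zero_of_transpose_eq_neg {S A : Matrix (Fin n) (Fin n) ℝ} (hS : Sᵀ = S)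
    (hA : Aᵀ = -A) : (S * A).trace = 0 := by
  have h : (S * A).trace = -(S * A).trace := by
    conv_lhs => rw [← Matrix.trace_transpose, Matrix.transpose_mul, hS, hA, Matrix.neg_mul,
      Matrix.trace_neg, Matrix.trace_mul_comm]
  linarith

/-- The matrix of the two-form `⟨a, D ·⟩ ∧ ⟨b, D ·⟩`. -/
def wedgeMatrix (D : EuclideanSpace ℝ (Fin n) →L[ℝ] F) (a b : F) : Matrix (Fin n) (Fin n) ℝ :=
  Matrix.of fun i j => ⟪D (EuclideanSpace.single i 1), a⟫ * ⟪b, D (EuclideanSpace.single j 1)⟫ -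
    ⟪b, D (EuclideanSpace.single i 1)⟫ * ⟪a, D (EuclideanSpace.single j 1)⟫

lemma wedgeMatrix_transpose (D : EuclideanSpace ℝ (Fin n) →L[ℝ] F) (a b : F) :
    (wedgeMatrix D a b)ᵀ = -wedgeMatrix D a b := by
  ext i j
  simp only [wedgeMatrix, Matrix.transpose_apply, Matrix.of_apply, Matrix.neg_apply,
    real_inner_comm]
  ring

/-- With `G` the Gram matrix, `h` the matrix of `S` and `A` the wedge matrix, `G⁻¹ A` and `G⁻¹ h G⁻¹
A` are products of a symmetric and an antisymmetric matrix, hence traceless. Only the terms in `r`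
and `s` survive. -/
lemma metricTrace_eq_of_pairing {D S B : EuclideanSpace ℝ (Fin n) →L[ℝ] F} {a b : F}
    {r c s : ℝ} (hD : Function.Injective D) (hS : ∀ v, ∃ w, S v = D w)
    (hsymm : ∀ u v, ⟪S u, D v⟫ = ⟪S v, D u⟫)
    (hB : ∀ u v, ⟪B u, D v⟫ = (⟪D u, a⟫ * ⟪b, D v⟫ - ⟪b, D u⟫ * ⟪a, D v⟫) + r * ⟪D u, D v⟫ +
      c * (⟪S u, a⟫ * ⟪b, D v⟫ - ⟪b, S u⟫ * ⟪a, D v⟫) - s * ⟪S u, D v⟫) :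
    metricTrace D B = n * r - s * metricTrace D S := by
  have hdet : IsUnit (pairing D D).det := isUnit_iff_ne_zero.2 (det_pairing_self_pos hD).ne'
  -- Since `S` is tangential, it expands in the frame `D e_k` with coefficient matrix `h G⁻¹`; the
  -- term with factor `c` then becomes `h G⁻¹ A`.
  have hSD : ∀ i, S (EuclideanSpace.single i 1) =
      ∑ k, (pairing S D * (pairing D D)⁻¹) i k • D (EuclideanSpace.single k 1) := fun i => by
    obtain ⟨w, hw⟩ := hS (EuclideanSpace.single i 1)
    conv_lhs => rw [hw, map_eq_sum_single]
    refine Finset.sum_congr rfl fun k _ => ?_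
    rw [← metricCoeff_map hD w k, ← hw, metricCoeff, Matrix.mul_apply]
    congr 1
    refine Finset.sum_congr rfl fun l _ => ?_
    rw [pairing_apply, mul_comm, ← pairing_self_inv_transpose D, Matrix.transpose_apply,
      pairing_self_inv_transpose]
  have hmat : pairing B D = wedgeMatrix D a b + r • pairing D D +
      c • (pairing S D * (pairing D D)⁻¹ * wedgeMatrix D a b) - s • pairing S D := by
    ext i j
    rw [pairing_apply, hB, hSD i]
    simp only [Matrix.sub_apply, Matrix.add_apply, Matrix.smul_apply, smul_eq_mul,
      pairing_apply, ← hSD i]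
    rw [Matrix.mul_apply, hSD i]
    simp only [wedgeMatrix, Matrix.of_apply, sum_inner, inner_sum, inner_smul_left,
      inner_smul_right, conj_trivial, Finset.sum_mul, ← Finset.sum_sub_distrib]
    congr 3
    refine Finset.sum_congr rfl fun k _ => ?_
    ring
  have hhs : (pairing S D)ᵀ = pairing S D := by
    ext i j
    exact hsymm _ _
  have h1 := trace_mul_eq_zero_of_transpose_eq_neg (pairing_self_inv_transpose D)
    (wedgeMatrix_transpose D a b)
  have h2 := trace_mul_eq_zero_of_transpose_eq_neg (S := (pairing D D)⁻¹ *
    (pairing S D * (pairing D D)⁻¹)) (by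
      rw [Matrix.transpose_mul, Matrix.transpose_mul, hhs, pairing_self_inv_transpose,
        Matrix.mul_assoc]) (wedgeMatrix_transpose D a b)
  rw [Matrix.mul_assoc] at h2
  unfold metricTrace
  rw [hmat, Matrix.mul_sub, Matrix.mul_add, Matrix.mul_add, Matrix.mul_smul, Matrix.mul_smul,
    Matrix.mul_smul, Matrix.nonsing_inv_mul _ hdet, Matrix.trace_sub, Matrix.trace_add,
    Matrix.trace_add, Matrix.trace_smul, Matrix.trace_smul, Matrix.trace_smul, h1, h2,
    Matrix.trace_one, Fintype.card_fin]
  simp only [smul_eq_mul]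
  ring

end CapillaryField

/-! ### The capillary vector field: boundary tangency and divergence. -/

section CapillaryField

variable {n : ℕ} {M : Type*} {x ν : M → EuclideanSpace ℝ (Fin (n + 1))}

/-- The tangential part of `X_a + c (⟨ν, a⟩ x - ⟨x, ν⟩ a)`. -/
def capillaryField (x ν : M → EuclideanSpace ℝ (Fin (n + 1))) (a : EuclideanSpace ℝ (Fin (n + 1)))
    (c : ℝ) (q : M) : EuclideanSpace ℝ (Fin (n + 1)) :=
  confField a (x q) + c • (⟪ν q, a⟫ • x q - ⟪x q, ν q⟫ • a) - ⟪confField a (x q), ν q⟫ • ν q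

lemma contDiff_confField (a : EuclideanSpace ℝ (Fin (n + 1))) :
    ContDiff ℝ ∞ (confField a) :=
  ((contDiff_id.inner ℝ contDiff_const).smul contDiff_id).sub
    ((contDiff_const.mul ((contDiff_id.norm_sq ℝ).add contDiff_const)).smul contDiff_const)

lemma contDiff_capillary (a : EuclideanSpace ℝ (Fin (n + 1))) (c : ℝ) :
    ContDiff ℝ ∞ fun z : EuclideanSpace ℝ (Fin (n + 1)) × EuclideanSpace ℝ (Fin (n + 1)) =>
      confField a z.1 + c • (⟪z.2, a⟫ • z.1 - ⟪z.1, z.2⟫ • a) - ⟪confField a z.1, z.2⟫ • z.2 := by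
  have hc : ContDiff ℝ ∞ fun z : EuclideanSpace ℝ (Fin (n + 1)) ×
      EuclideanSpace ℝ (Fin (n + 1)) => confField a z.1 := (contDiff_confField a).comp contDiff_fst
  have h1 := (contDiff_snd (𝕜 := ℝ) (E := EuclideanSpace ℝ (Fin (n + 1)))
    (F := EuclideanSpace ℝ (Fin (n + 1))) (n := ∞))
  have h2 := (contDiff_fst (𝕜 := ℝ) (E := EuclideanSpace ℝ (Fin (n + 1)))
    (F := EuclideanSpace ℝ (Fin (n + 1))) (n := ∞))
  have h3 := (h1.inner ℝ (contDiff_const (c := a))).smul h2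
  have h4 := (h2.inner ℝ h1).smul (contDiff_const (c := a))
  exact (hc.add ((h3.sub h4).const_smul c)).sub ((hc.inner ℝ h1).smul h1)

lemma inner_capillaryField_normal (hν : ∀ q, ‖ν q‖ = 1) (a : EuclideanSpace ℝ (Fin (n + 1)))
    (c : ℝ) (q : M) : ⟪capillaryField x ν a c q, ν q⟫ = 0 := by
  simp only [capillaryField, inner_sub_left, inner_add_left, inner_smul_left, conj_trivial,
    real_inner_self_eq_norm_sq, hν, real_inner_comm a (ν q)]
  ring

/-- On the sphere `⟨X_a, x⟩ = 0` and `⟨X_a, ν⟩ = -c ⟨x, a⟩ - ⟨ν, a⟩`. The correction contributes `c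
(⟨ν, a⟩ + c ⟨x, a⟩)`, which cancels the contribution of the removed normal part. -/
lemma inner_capillaryField_position (a : EuclideanSpace ℝ (Fin (n + 1))) {c : ℝ} {q : M}
    (hxq : ‖x q‖ = 1) (hc : ⟪ν q, x q⟫ = -c) : ⟪capillaryField x ν a c q, x q⟫ = 0 := by
  have hc' : ⟪x q, ν q⟫ = -c := by rw [real_inner_comm, hc]
  simp only [capillaryField, confField, inner_sub_left, inner_add_left, inner_smul_left,
    conj_trivial, real_inner_self_eq_norm_sq, hxq, hc, hc', real_inner_comm (x q) a,
    real_inner_comm (ν q) a]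
  ring

variable [NeZero n] [TopologicalSpace M] [ChartedSpace (EuclideanHalfSpace n) M]

lemma contMDiff_capillaryField
    (hx : ContMDiff (𝓡∂ n) 𝓘(ℝ, EuclideanSpace ℝ (Fin (n + 1))) ∞ x)
    (hν : ContMDiff (𝓡∂ n) 𝓘(ℝ, EuclideanSpace ℝ (Fin (n + 1))) ∞ ν)
    (a : EuclideanSpace ℝ (Fin (n + 1))) (c : ℝ) :
    ContMDiff (𝓡∂ n) 𝓘(ℝ, EuclideanSpace ℝ (Fin (n + 1))) ∞ (capillaryField x ν a c) := by
  have h := (contDiff_capillary a c).contMDiff.comp (hx.prodMk_space hν)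
  exact h

variable [IsManifold (𝓡∂ n) ∞ M]

/-- The product rule, paired with a tangent vector. The derivative of the coefficient of `ν` drops
out because `ν` is normal, and so does `⟨dx u, ν⟩`. The result has the shape required by
`metricTrace_eq_of_pairing`. -/
lemma inner_diff_capillaryField (hx : IsSmoothImmersion x) (hν : IsUnitNormal x ν)
    (a : EuclideanSpace ℝ (Fin (n + 1))) (c : ℝ) (q : M) (u v : EuclideanSpace ℝ (Fin n)) :
    ⟪diff (capillaryField x ν a c) q u, diff x q v⟫ =
      (⟪diff x q u, a⟫ * ⟪x q, diff x q v⟫ - ⟪x q, diff x q u⟫ * ⟪a, diff x q v⟫) +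
        (⟪x q, a⟫ + c * ⟪ν q, a⟫) * ⟪diff x q u, diff x q v⟫ +
        c * (⟪diff ν q u, a⟫ * ⟪x q, diff x q v⟫ - ⟪x q, diff ν q u⟫ * ⟪a, diff x q v⟫) -
        ⟪confField a (x q), ν q⟫ * ⟪diff ν q u, diff x q v⟫ := by
  have hX := hasFDerivWithinAt_diff hx.smooth q
  have hN := hasFDerivWithinAt_diff hν.smooth q
  have ha := hasFDerivWithinAt_const (𝕜 := ℝ) a (extChartAt (𝓡∂ n) q q) (range (𝓡∂ n))
  have hconf := ((hX.inner ℝ ha).smul hX).sub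
    (((hX.norm_sq.add_const 1).const_mul (1 / 2 : ℝ)).smul_const a)
  have hW := (hconf.add ((((hN.inner ℝ ha).smul hX).sub
    ((hX.inner ℝ hN).smul_const a)).const_smul c)).sub ((hconf.inner ℝ hN).smul hN)
  have h := (uniqueDiffWithinAt_range_extChartAt q).eq
    (hasFDerivWithinAt_diff (contMDiff_capillaryField hx.smooth hν.smooth a c) q) hW
  have h1 := hν.inner_eq_zero q v
  have h2 := hν.inner_eq_zero q u
  rw [real_inner_comm] at h2
  have h3 := congrArg (fun w => ⟪w, diff x q v⟫) (DFunLike.congr_fun h u)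
  simp only [_root_.sub_apply, _root_.add_apply, _root_.smul_apply, ContinuousLinearMap.comp_apply,
    ContinuousLinearMap.smulRight_apply, fderivInnerCLM_apply, ContinuousLinearMap.prod_apply,
    Function.comp_apply, Pi.sub_apply, Pi.smul_apply', extChartAt_to_inv, _root_.zero_apply,
    inner_sub_left, inner_add_left, inner_smul_left, inner_zero_right, conj_trivial, h1, h2] at h3
  refine Eq.trans h3 ?_
  simp [confField, inner_sub_left, inner_smul_left, real_inner_comm]
  ring

lemma divergence_capillaryField (hx : IsSmoothImmersion x) (hν : IsUnitNormal x ν)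
    (a : EuclideanSpace ℝ (Fin (n + 1))) (c : ℝ) (q : M) :
    divergence x (capillaryField x ν a c) q = n * ⟪x q + c • ν q, a⟫ -
      meanCurvature x ν q * ⟪confField a (x q), ν q⟫ := by
  rw [divergence, metricTrace_eq_of_pairing (hx.injective_diff q)
    (fun v => exists_eq_map_of_inner_eq_zero (hx.injective_diff q) (hν.norm_eq_one q)
      (hν.inner_eq_zero q) (inner_diff_normal_self hν q v))
    (inner_diff_normal_symm hx hν q) (inner_diff_capillaryField hx hν a c q),
    meanCurvature_eq_divergence, divergence, inner_add_left, inner_smul_left, conj_trivial]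
  ring

end CapillaryField

end CapillaryBall

end

/-! ### The integral identity for capillary hypersurfaces. -/

theorem mainTheorem5 {n : ℕ} [NeZero n] {M : Type*} [TopologicalSpace M] [T2Space M]
    [CompactSpace M] [ChartedSpace (EuclideanHalfSpace n) M] [IsManifold (𝓡∂ n) ∞ M]
    [MeasurableSpace M] [BorelSpace M]
    (x ν : M → EuclideanSpace ℝ (Fin (n + 1))) (hx : CapillaryBall.IsSmoothImmersion x)
    (hball : ∀ p, ‖x p‖ ≤ 1) (hν : CapillaryBall.IsUnitNormal x ν)
    (θ : ℝ) (hθ : θ ∈ Set.Ioo 0 Real.pi) (hangle : CapillaryBall.MeetsSphereAtAngle x ν θ)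
    (a : EuclideanSpace ℝ (Fin (n + 1))) :
    MeasureTheory.Integrable (fun p => (n : ℝ) * ⟪x p + Real.cos θ • ν p, a⟫)
        (CapillaryBall.area x) ∧
      MeasureTheory.Integrable (fun p => CapillaryBall.meanCurvature x ν p *
        ⟪CapillaryBall.confField a (x p), ν p⟫) (CapillaryBall.area x) ∧
      (∫ p, (n : ℝ) * ⟪x p + Real.cos θ • ν p, a⟫ ∂(CapillaryBall.area x) =
        ∫ p, CapillaryBall.meanCurvature x ν p * ⟪CapillaryBall.confField a (x p), ν p⟫
          ∂(CapillaryBall.area x)) ∧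
      (θ = Real.pi / 2 →
        (n : ℝ) * ∫ p, ⟪x p, a⟫ ∂(CapillaryBall.area x) =
          ∫ p, CapillaryBall.meanCurvature x ν p * ⟪CapillaryBall.confField a (x p), ν p⟫
            ∂(CapillaryBall.area x)) := by
  have := CapillaryBall.isFiniteMeasure_area hx
  have hxc : Continuous x := hx.smooth.continuous
  have hνc : Continuous ν := hν.smooth.continuous
  have hconf : Continuous fun p => CapillaryBall.confField a (x p) := by
    unfold CapillaryBall.confField
    fun_prop
  have hHc : Continuous (CapillaryBall.meanCurvature x ν) :=
    CapillaryBall.continuous_divergence hx hν.smooth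
  have hint : ∀ {f : M → ℝ}, Continuous f → Integrable f (CapillaryBall.area x) := fun hf =>
    hf.integrable_of_hasCompactSupport (HasCompactSupport.of_compactSpace _)
  have h1 : Integrable (fun p => (n : ℝ) * ⟪x p + Real.cos θ • ν p, a⟫) (CapillaryBall.area x) :=
    hint (by fun_prop)
  have h2 : Integrable (fun p => CapillaryBall.meanCurvature x ν p *
      ⟪CapillaryBall.confField a (x p), ν p⟫) (CapillaryBall.area x) :=
    hint (hHc.mul (hconf.inner hνc))
  -- The minus sign appears because the angle is measured from `-ν`.
  have hcos : ∀ p ∈ (𝓡∂ n).boundary M, ⟪ν p, x p⟫ = -Real.cos θ := fun p hp => by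
    have h := InnerProductGeometry.cos_angle (-ν p) (x p)
    rw [(hangle p hp).2, (hangle p hp).1, norm_neg, hν.norm_eq_one, inner_neg_left] at h
    linarith
  have hmain : ∫ p, (n : ℝ) * ⟪x p + Real.cos θ • ν p, a⟫ ∂(CapillaryBall.area x) =
      ∫ p, CapillaryBall.meanCurvature x ν p * ⟪CapillaryBall.confField a (x p), ν p⟫
        ∂(CapillaryBall.area x) := by
    rw [← sub_eq_zero, ← integral_sub h1 h2,
      ← CapillaryBall.integral_divergence_eq_zero hx hν
        (CapillaryBall.contMDiff_capillaryField hx.smooth hν.smooth a (Real.cos θ))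
        (CapillaryBall.inner_capillaryField_normal hν.norm_eq_one a _)
        (fun p hp => (hangle p hp).1) (fun p hp h => ?_)
        (fun p hp => CapillaryBall.inner_capillaryField_position a (hangle p hp).1 (hcos p hp))]
    · exact integral_congr_ae (Filter.Eventually.of_forall fun p =>
        (CapillaryBall.divergence_capillaryField hx hν a _ p).symm)
    · rw [hcos p hp] at h
      -- Transversality: `cos θ ^ 2 = 1` would contradict `sin θ > 0`.
      have hs := Real.sin_pos_of_pos_of_lt_pi hθ.1 hθ.2
      nlinarith [Real.sin_sq_add_cos_sq θ, pow_pos hs 2]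
  refine ⟨h1, h2, hmain, fun hθ2 => ?_⟩
  rw [← hmain, hθ2, Real.cos_pi_div_two, ← integral_const_mul]
  simp only [zero_smul, add_zero]
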